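/- Let $K$ be a field of characteristic different from $2$ and let $V$ be a finite-dimensional $K$-vector space with a nondegenerate symmetric bilinear form $\langle\cdot,\cdot\rangle$ of maximal Witt index $p=\lfloor \dim V/2\rfloor\ge 1$; that is, $V$ contains a $p$-dimensional subspace on which the form vanishes identically. Let $$\widehat{Gr}_{\mathrm{iso}}(p,V)=\{v_1\wedge\cdots\wedge v_p \mid v_1,\dots,v_p\in V,\ \langle v_i,v_j\rangle=0 \text{ for all } i,j\}\subset \bigwedge\nolimits^p V$$ be the maximal isotropic Grassmann cone. A quadric is the zero set of a quadratic form on $\bigwedge^pV$, and its rank is the rank of the associated symmetric bilinear form. "Defined" means set-theoretically: a set is the common zero set of the given forms. (1) If $\dim V=2p+1$, then $\widehat{Gr}_{\mathrm{iso}}(p,V)$ is defined by quadrics of rank at most $4$. (2) If $\dim V=2p$ and $K$ is infinite, then $\widehat{Gr}_{\mathrm{iso}}(p,V)$ has exactly two irreducible components in the Zariski topology of $\bigwedge^pV$, and each of them is defined by (homogeneous) linear equations and quadrics of rank at most $4$. (3) If $\dim V=2p$ and $K$ is arbitrary with algebraic closure $\overline K$, then $\widehat{Gr}_{\mathrm{iso}}(p,\overline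 K\otimes_K V)$ has exactly two irreducible components in the Zariski topology of $\bigwedge^p(\overline K\otimes_K V)$, and each of them is defined by (homogeneous) linear equations and quadrics of rank at most $4$ with coefficients in $K$. -/

import Mathlib

open scoped TensorProduct

/-- The isotropic Grassmann cone: all `v₁ ∧ ⋯ ∧ vₖ` with `⟨vᵢ, vⱼ⟩ = 0` for all `i, j`. -/
def isoGrassmannCone {K V : Type*} [Field K] [AddCommGroup V] [Module K V]
    (B : LinearMap.BilinForm K V) (k : ℕ) : Set (⋀[K]^k V) :=
  {ω | ∃ v : Fin k → V, (∀ i j, B (v i) (v j) = 0) ∧ ω = exteriorPower.ιMulti K k v}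

/-- The algebra of polynomial functions on a vector space: the algebra of functions
generated by the linear forms. -/
def polyFunctions (K M : Type*) [Field K] [AddCommGroup M] [Module K M] :
    Subalgebra K (M → K) :=
  Algebra.adjoin K (Set.range fun l : Module.Dual K M => (l : M → K))

/-- The common zero set of a set of functions. -/
def zeroLocus {K M : Type*} [Field K] (S : Set (M → K)) : Set M :=
  {x | ∀ f ∈ S, f x = 0}

/-- The Zariski topology on (the points of) a vector space: the closed sets are the common
zero sets of sets of polynomial functions. -/
def zariskiTopology (K M : Type*) [Field K] [AddCommGroup M] [Module K M] :
    TopologicalSpace M :=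
  TopologicalSpace.ofClosed
    {Z | ∃ S : Set (M → K), S ⊆ polyFunctions K M ∧ Z = zeroLocus S}
    ⟨{1}, by simp, by ext; simp [zeroLocus]⟩
    (by
      intro A hA
      refine ⟨{f | f ∈ polyFunctions K M ∧ ∃ Z ∈ A, ∀ x ∈ Z, f x = 0},
        fun f hf => hf.1, ?_⟩
      ext x
      constructor
      · rintro hx f ⟨-, Z, hZ, hf⟩
        exact hf x (hx Z hZ)
      · intro hx Z hZ
        obtain ⟨S, hS, rfl⟩ := hA hZ
        exact fun f hf => hx f ⟨hS hf, _, hZ, fun y hy => hy f hf⟩)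
    (by
      rintro _ ⟨S, hS, rfl⟩ _ ⟨T, hT, rfl⟩
      refine ⟨{h | ∃ f ∈ S, ∃ g ∈ T, h = f * g}, ?_, ?_⟩
      · rintro _ ⟨f, hf, g, hg, rfl⟩
        exact mul_mem (hS hf) (hT hg)
      · ext x
        constructor
        · rintro (hx | hx) _ ⟨f, hf, g, hg, rfl⟩
          · simp [hx f hf]
          · simp [hx g hg]
        · intro hx
          by_contra hcon
          simp only [Set.mem_union, not_or, zeroLocus, Set.mem_ofPred_eq, not_forall] at hcon
          obtain ⟨⟨f, hf, hfx⟩, ⟨g, hg, hgx⟩⟩ := hcon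
          exact mul_ne_zero hfx hgx (hx _ ⟨f, hf, g, hg, rfl⟩))

/-- The irreducible components of a subset `X` of a vector space, with respect to the
Zariski topology: the maximal irreducible subsets of `X`. -/
def zariskiComponents (K : Type*) {M : Type*} [Field K] [AddCommGroup M] [Module K M]
    (X : Set M) : Set (Set M) :=
  {Z | Maximal (fun Y : Set M => Y ⊆ X ∧ @IsIrreducible M (zariskiTopology K M) Y) Z}

/-- The rank of a quadratic form (in characteristic not two): the rank of its polar form. -/
noncomputable def quadricRank {K M : Type*} [Field K] [AddCommGroup M] [Module K M]
    (q : QuadraticForm K M) : ℕ :=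
  Module.finrank K (LinearMap.range q.polarBilin)

/-- `Z` is set-theoretically defined by quadrics of rank at most `r`. -/
def DefinedByQuadrics (K : Type*) {M : Type*} [Field K] [AddCommGroup M] [Module K M]
    (r : ℕ) (Z : Set M) : Prop :=
  ∃ Q : Set (QuadraticForm K M), (∀ q ∈ Q, quadricRank q ≤ r) ∧
    Z = {x | ∀ q ∈ Q, q x = 0}

/-- `Z` is set-theoretically defined by linear equations and quadrics of rank at most `r`. -/
def DefinedByLinearAndQuadrics (K : Type*) {M : Type*} [Field K] [AddCommGroup M] [Module K M]
    (r : ℕ) (Z : Set M) : Prop :=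
  ∃ (L : Set (Module.Dual K M)) (Q : Set (QuadraticForm K M)),
    (∀ q ∈ Q, quadricRank q ≤ r) ∧
    Z = {x | (∀ l ∈ L, l x = 0) ∧ ∀ q ∈ Q, q x = 0}

/-- The canonical map `⋀ᵏ V → ⋀ᵏ (F ⊗ V)`, `v₁ ∧ ⋯ ∧ vₖ ↦ (1 ⊗ v₁) ∧ ⋯ ∧ (1 ⊗ vₖ)`,
for a field extension `F` of `K`. -/
noncomputable def extendScalars (K F V : Type*) [Field K] [Field F] [Algebra K F]
    [AddCommGroup V] [Module K V] (k : ℕ) : ⋀[K]^k V →ₗ[K] ⋀[F]^k (F ⊗[K] V) :=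
  exteriorPower.alternatingMapLinearEquiv
    { ((exteriorPower.ιMulti F k (M := F ⊗[K] V)).toMultilinearMap.restrictScalars
          K).compLinearMap (fun _ => TensorProduct.mk K F V 1) with
      map_eq_zero_of_eq' := fun v i j hv hij =>
        (exteriorPower.ιMulti F k (M := F ⊗[K] V)).map_eq_zero_of_eq
          (fun i => (1 : F) ⊗ₜ[K] v i) (by simp only [hv]) hij }

/-- A subset `Z` of `⋀ᵏ (F ⊗ V)` is set-theoretically defined by linear equations and quadrics
of rank at most `r`, all with coefficients in the subfield `K`; that is, these linear and
quadratic forms take values in `K` on `⋀ᵏ V`. -/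
def DefinedByLinearAndQuadricsOver (K : Type*) {F V : Type*} [Field K] [Field F] [Algebra K F]
    [AddCommGroup V] [Module K V] {k : ℕ} (r : ℕ) (Z : Set (⋀[F]^k (F ⊗[K] V))) : Prop :=
  ∃ (L : Set (Module.Dual F (⋀[F]^k (F ⊗[K] V))))
    (Q : Set (QuadraticForm F (⋀[F]^k (F ⊗[K] V)))),
    (∀ l ∈ L, ∀ ω : ⋀[K]^k V, l (extendScalars K F V k ω) ∈ (algebraMap K F).range) ∧
    (∀ q ∈ Q, ∀ ω : ⋀[K]^k V, q (extendScalars K F V k ω) ∈ (algebraMap K F).range) ∧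
    (∀ q ∈ Q, quadricRank q ≤ r) ∧
    Z = {x | (∀ l ∈ L, l x = 0) ∧ ∀ q ∈ Q, q x = 0}

/-! Let `γ` be the spin representation of `V` on the functions on `{0,1}^p`, so that `γ(v)² = B(v,
v)`. Quantization sends a wedge of pairwise orthogonal vectors to the product of their `γ`'s; on `⋀ᵖ
V` it is injective, and its value at `ω` is called the symbol of `ω`. The key claim (`mem_cone_iff`)
is that `ω` lies in the isotropic cone exactly when its symbol has rank at most one. The `2 × 2`
minors of the symbol are then the required quadrics `l₁ l₂ - l₃ l₄`, of rank at most 4.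

If `ω = n₁ ∧ ⋯ ∧ nₚ` is nonzero and isotropic with span `N`, every column of its symbol is a spinor
killed by `N`. Such spinors are unique up to scalars: this is computed for one `N` and transported
by reflections, which act transitively on maximal isotropic subspaces. Conversely, let the symbol be
`s φᵀ ≠ 0`. For an orthogonal basis `u` with `qⱼ = B(uⱼ, uⱼ)`, every symbol `c` satisfies `∑ qⱼ⁻¹
γ(uⱼ) c γ(uⱼ) = (-1)ᵖ (dim V - 2p) c`. If `w(x)` represents `v ↦ φ(γ(v) x)`, this reads `γ(w(x)) s =
(-1)ᵖ (dim V - 2p) φ(x) s`. The factor `dim V - 2p` is 0 or 1, and a dimension count shows that the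
annihilator `N` of `s` has dimension `p`. Then `N` kills `φ` too, so `s` and `φ` are determined by
`N` up to scalars, and injectivity makes `ω` a multiple of the wedge of a basis of `N`
(`mem_cone_of_minorsVanish`).

If `dim V = 2p`, a diagonal chirality operator anticommutes with all `γ(v)`. Symbols of cone
elements are eigenvectors for `±1`, a linear condition that splits the cone into two closed pieces.
Nonzero points of the same piece are linked by an even number of reflections; moving the reflecting
vectors along lines until they cancel in pairs joins the points by a polynomial curve, so each piece
is irreducible over an infinite field. Over the algebraic closure the coordinates come from `K`,
hence so do the equations. -/

/-! ### Clifford maps and quantization of exterior powers. -/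

section Clifford

variable {K V A : Type*} [Field K] [AddCommGroup V] [Module K V] [Ring A] [Algebra K A]

/-- A linear map into an algebra satisfying the Clifford relation `γ(v)² = B(v, v)`. -/
def IsCliffordMap (B : LinearMap.BilinForm K V) (γ : V →ₗ[K] A) : Prop :=
  ∀ v, γ v * γ v = algebraMap K A (B v v)

theorem IsCliffordMap.anticomm {B : LinearMap.BilinForm K V} {γ : V →ₗ[K] A}
    (hγ : IsCliffordMap B γ) (hB : B.IsSymm) (v w : V) :
    γ v * γ w + γ w * γ v = algebraMap K A (2 * B v w) := by
  have h := hγ (v + w)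
  simp only [map_add, LinearMap.add_apply, add_mul, mul_add, hγ v, hγ w, hB.eq w v] at h
  rw [two_mul, map_add]
  have h' : algebraMap K A (B v v) + (γ v * γ w + γ w * γ v) + algebraMap K A (B w w) =
      algebraMap K A (B v v) + (algebraMap K A (B v w) + algebraMap K A (B v w)) +
        algebraMap K A (B w w) := by
    convert h using 1
    · abel
    · abel
  exact add_left_cancel (add_right_cancel h')

theorem IsCliffordMap.anticomm_of_ortho {B : LinearMap.BilinForm K V} {γ : V →ₗ[K] A}
    (hγ : IsCliffordMap B γ) (hB : B.IsSymm) {v w : V} (h : B v w = 0) :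
    γ v * γ w = -(γ w * γ v) := by
  have := hγ.anticomm hB v w
  rw [h, mul_zero, map_zero] at this
  exact eq_neg_of_add_eq_zero_left this

/-- Contraction is an antiderivation, so it kills any product of vectors on which `d` vanishes. -/
theorem contractLeft_list_prod_eq_zero {Q : QuadraticForm K V} (d : Module.Dual K V) (l : List V)
    (h : ∀ v ∈ l, d v = 0) :
    CliffordAlgebra.contractLeft d (l.map (CliffordAlgebra.ι Q)).prod = 0 := by
  induction l with
  | nil => simp
  | cons a l ih =>
    rw [List.map_cons, List.prod_cons, CliffordAlgebra.contractLeft_ι_mul, h a (by simp),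
      ih fun v hv => h v (by simp [hv])]
    simp

/-- Each change-of-form correction contracts the later factors with `B v`, and orthogonality makes
this contraction zero. -/
theorem changeForm_list_prod {B : LinearMap.BilinForm K V} {Q Q' : QuadraticForm K V}
    (h : B.toQuadraticMap = Q' - Q) (l : List V) (hl : l.Pairwise fun v w => B v w = 0) :
    CliffordAlgebra.changeForm h (l.map (CliffordAlgebra.ι Q)).prod =
      (l.map (CliffordAlgebra.ι Q')).prod := by
  induction l with
  | nil => simp
  | cons a l ih =>
    rw [List.pairwise_cons] at hl
    rw [List.map_cons, List.prod_cons, CliffordAlgebra.changeForm_ι_mul, ih hl.2,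
      contractLeft_list_prod_eq_zero _ _ hl.1, sub_zero, List.map_cons, List.prod_cons]

/-- The quantization of a Clifford map in degree `k`: the linear map on `⋀ᵏ V` sending
`v₁ ∧ ⋯ ∧ vₖ` to `γ(v₁) ⋯ γ(vₖ)` for pairwise orthogonal vectors. -/
noncomputable def IsCliffordMap.quantize {B : LinearMap.BilinForm K V} {γ : V →ₗ[K] A}
    (hγ : IsCliffordMap B γ) (k : ℕ) : ⋀[K]^k V →ₗ[K] A :=
  (CliffordAlgebra.lift B.toQuadraticMap ⟨γ, hγ⟩).toLinearMap ∘ₗ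
    CliffordAlgebra.changeForm (Q := 0) (Q' := B.toQuadraticMap) (B := B) (sub_zero _).symm ∘ₗ
    (⋀[K]^k V).subtype

theorem IsCliffordMap.quantize_ιMulti {B : LinearMap.BilinForm K V} {γ : V →ₗ[K] A}
    (hγ : IsCliffordMap B γ) {k : ℕ} (v : Fin k → V) (hv : ∀ i j, i < j → B (v i) (v j) = 0) :
    hγ.quantize k (exteriorPower.ιMulti K k v) = (List.ofFn fun i => γ (v i)).prod := by
  -- The exterior algebra is by definition the Clifford algebra of the zero form.
  have h1 : (exteriorPower.ιMulti K k v : ExteriorAlgebra K V) =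
      ((List.ofFn v).map (CliffordAlgebra.ι (0 : QuadraticForm K V))).prod := by
    rw [exteriorPower.ιMulti_apply_coe, ExteriorAlgebra.ιMulti_apply, List.map_ofFn]
    rfl
  have h2 := changeForm_list_prod (B := B) (Q := 0) (Q' := B.toQuadraticMap) (sub_zero _).symm
    (List.ofFn v) (by rw [List.pairwise_ofFn]; exact fun i j hij => hv i j hij)
  simp only [quantize, LinearMap.comp_apply, Submodule.subtype_apply]
  rw [h1]
  erw [h2]
  rw [AlgHom.toLinearMap_apply, map_list_prod, List.map_map, List.map_ofFn]
  congr 2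
  funext i
  exact CliffordAlgebra.lift_ι_apply (Q := B.toQuadraticMap) γ hγ (v i)

end Clifford

/-! ### Products of anticommuting elements. -/

section Signs

variable {K A I : Type*} [Field K] [Ring A] [Algebra K A] [DecidableEq I]

/-- Each factor passed costs a sign, except `g j` itself; the extra exponent undoes that one sign.
-/
theorem mul_list_prod_anticomm (g : I → A) (hg : ∀ i j, i ≠ j → g i * g j = -(g j * g i))
    (j : I) (l : List I) (hl : l.Nodup) :
    g j * (l.map g).prod =
      (-1) ^ (l.length + if j ∈ l then 1 else 0) * ((l.map g).prod * g j) := by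
  induction l with
  | nil => simp
  | cons a l ih =>
    rw [List.nodup_cons] at hl
    have ih := ih hl.2
    rw [List.map_cons, List.prod_cons, ← mul_assoc, List.length_cons]
    by_cases hja : j = a
    · subst hja
      have : j ∉ l := hl.1
      simp only [this, if_false, add_zero] at ih
      simp only [List.mem_cons, true_or, if_true]
      rw [pow_add, pow_add, pow_one, mul_assoc ((-1 : A) ^ l.length), neg_one_mul, neg_neg,
        mul_one]
      calc g j * g j * (l.map g).prod = g j * (g j * (l.map g).prod) := mul_assoc _ _ _
        _ = g j * ((-1) ^ l.length * ((l.map g).prod * g j)) := by rw [← ih]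
        _ = g j * (-1) ^ l.length * ((l.map g).prod * g j) := (mul_assoc _ _ _).symm
        _ = (-1) ^ l.length * g j * ((l.map g).prod * g j) := by
          rw [((Commute.neg_one_right (g j)).pow_right _).eq]
        _ = _ := by simp only [mul_assoc]
    · rw [hg j a hja, neg_mul, mul_assoc, ih]
      simp only [List.mem_cons, hja, false_or]
      rw [add_right_comm, pow_succ]
      simp only [mul_neg, mul_one, neg_mul, mul_assoc]
      congr 1
      rw [← mul_assoc, ((Commute.neg_one_right (g a)).pow_right _).eq, mul_assoc]

theorem mul_list_prod_eq_zero (l : List A) (hsq : ∀ a ∈ l, a * a = 0)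
    (hl : ∀ a ∈ l, ∀ b ∈ l, a * b = -(b * a)) {a : A} (ha : a ∈ l) : a * l.prod = 0 := by
  induction l with
  | nil => simp at ha
  | cons b l ih =>
    rw [List.prod_cons, ← mul_assoc]
    by_cases hab : a = b
    · rw [hab, hsq b (by simp), zero_mul]
    · have ha' : a ∈ l := by simpa [hab] using ha
      rw [hl a ha b (by simp), neg_mul, mul_assoc, ih (fun a h => hsq a (by simp [h]))
        (fun a h b h' => hl a (by simp [h]) b (by simp [h'])) ha', mul_zero, neg_zero]

theorem list_prod_mul_eq_zero (l : List A) (hsq : ∀ a ∈ l, a * a = 0)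
    (hl : ∀ a ∈ l, ∀ b ∈ l, a * b = -(b * a)) {a : A} (ha : a ∈ l) : l.prod * a = 0 := by
  induction l with
  | nil => simp at ha
  | cons b l ih =>
    rw [List.prod_cons, mul_assoc]
    by_cases ha' : a ∈ l
    · rw [ih (fun a h => hsq a (by simp [h]))
        (fun a h b h' => hl a (by simp [h]) b (by simp [h'])) ha', mul_zero]
    · have hab : a = b := by simpa [ha'] using ha
      -- Two copies of `b` separated by factors that anticommute with `b` can be brought together,
      -- and `b * b = 0`.
      have : ∀ l' : List A, (∀ c ∈ l', c ∈ b :: l) → b * l'.prod * b = 0 := by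
        intro l' hl'
        induction l' with
        | nil => simp [hsq b (by simp)]
        | cons c l' ih' =>
          rw [List.prod_cons, ← mul_assoc, hl b (by simp) c (hl' c (by simp)), neg_mul, neg_mul,
            mul_assoc c, mul_assoc c, ih' fun c h => hl' c (by simp [h]), mul_zero, neg_zero]
      rw [hab, ← mul_assoc, this l fun c h => by simp [h]]

end Signs

/-! ### Quantization in an orthogonal basis. -/

section OrthogonalBasis

variable {K V A ι : Type*} [Field K] [AddCommGroup V] [Module K V] [Ring A] [Algebra K A]
  [LinearOrder ι]

open Set.powersetCard in
theorem IsCliffordMap.quantize_ιMulti_family {B : LinearMap.BilinForm K V} {γ : V →ₗ[K] A}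
    (hγ : IsCliffordMap B γ) (k : ℕ) {u : ι → V} (hu : ∀ i j, i ≠ j → B (u i) (u j) = 0)
    (s : Set.powersetCard ι k) :
    hγ.quantize k (exteriorPower.ιMulti_family K k u s) =
      ((List.ofFn (ofFinEmbEquiv.symm s)).map fun i => γ (u i)).prod := by
  rw [exteriorPower.ιMulti_family, hγ.quantize_ιMulti, List.map_ofFn]
  · rfl
  · intro i j hij
    exact hu _ _ fun h => hij.ne ((ofFinEmbEquiv.symm s).injective h)

variable (k : ℕ)

/-- The projection of `⋀ᵏ V` onto the span of those basis elements `u_{i₁} ∧ ⋯ ∧ u_{iₖ}` that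
involve a given index. -/
noncomputable def indexProjection (u : Module.Basis ι K V) (j : ι) : ⋀[K]^k V →ₗ[K] ⋀[K]^k V :=
  (u.exteriorPower k).constr K fun s => if j ∈ s.val then u.exteriorPower k s else 0

theorem indexProjection_basis (u : Module.Basis ι K V) (j : ι) (s : Set.powersetCard ι k) :
    indexProjection k u j (u.exteriorPower k s) = if j ∈ s.val then u.exteriorPower k s else 0 := by
  rw [indexProjection, Module.Basis.constr_basis]

theorem indexProjection_repr (u : Module.Basis ι K V) (j : ι) (ω : ⋀[K]^k V)
    (s : Set.powersetCard ι k) :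
    (u.exteriorPower k).repr (indexProjection k u j ω) s =
      if j ∈ s.val then (u.exteriorPower k).repr ω s else 0 := by
  have : (u.exteriorPower k).coord s ∘ₗ indexProjection k u j =
      (if j ∈ s.val then (1 : K) else 0) • (u.exteriorPower k).coord s := by
    refine (u.exteriorPower k).ext fun t => ?_
    rw [LinearMap.comp_apply, indexProjection_basis, LinearMap.smul_apply,
      Module.Basis.coord_apply, Module.Basis.coord_apply]
    by_cases hst : s = t
    · subst hst; split_ifs <;> simp
    · have h0 : (u.exteriorPower k).repr (u.exteriorPower k t) s = 0 := by
        rw [Module.Basis.repr_self, Finsupp.single_eq_of_ne hst]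
      split_ifs <;> simp only [h0, map_zero, Finsupp.zero_apply, smul_zero]
  have h := LinearMap.congr_fun this ω
  rw [LinearMap.comp_apply, LinearMap.smul_apply, Module.Basis.coord_apply,
    Module.Basis.coord_apply] at h
  rw [h]
  split_ifs <;> simp

/-- A basis monomial of degree `k` involves exactly `k` indices. -/
theorem sum_indexProjection [Fintype ι] (u : Module.Basis ι K V) (ω : ⋀[K]^k V) :
    ∑ j, indexProjection k u j ω = (k : K) • ω := by
  have : ∑ j, indexProjection k u j = (k : K) • (LinearMap.id : ⋀[K]^k V →ₗ[K] ⋀[K]^k V) := by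
    refine (u.exteriorPower k).ext fun s => ?_
    rw [LinearMap.sum_apply]
    simp only [indexProjection_basis]
    rw [← Finset.sum_filter, Finset.sum_const]
    have : (Finset.univ.filter fun j => j ∈ s.val) = s.val := by ext; simp
    rw [this, s.prop]
    simp [Nat.cast_smul_eq_nsmul]
  simpa using LinearMap.congr_fun this ω

-- Moving `γ(uⱼ)` through a basis monomial gives the sign `(-1)^k`, with one further sign if `j`
-- occurs in it. The operator `1 - 2P`, with `P` the index projection, records that further sign.
open Set.powersetCard in
theorem IsCliffordMap.conj_quantize {B : LinearMap.BilinForm K V} {γ : V →ₗ[K] A}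
    (hγ : IsCliffordMap B γ) (hB : B.IsSymm) (u : Module.Basis ι K V)
    (hu : ∀ i j, i ≠ j → B (u i) (u j) = 0) (j : ι) (ω : ⋀[K]^k V) :
    γ (u j) * hγ.quantize k ω * γ (u j) =
      ((-1) ^ k * B (u j) (u j)) • hγ.quantize k (ω - (2 : K) • indexProjection k u j ω) := by
  have key : (LinearMap.mulRight K (γ (u j))) ∘ₗ (LinearMap.mulLeft K (γ (u j))) ∘ₗ
      hγ.quantize k = ((-1) ^ k * B (u j) (u j)) •
        (hγ.quantize k ∘ₗ (LinearMap.id - (2 : K) • indexProjection k u j)) := by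
    refine (u.exteriorPower k).ext fun s => ?_
    simp only [LinearMap.comp_apply, LinearMap.mulRight_apply, LinearMap.mulLeft_apply,
      LinearMap.smul_apply, LinearMap.sub_apply, LinearMap.id_apply, indexProjection_basis]
    have hsign := mul_list_prod_anticomm (fun i => γ (u i))
      (fun i j hij => hγ.anticomm_of_ortho hB (hu i j hij)) j (List.ofFn (ofFinEmbEquiv.symm s))
      (List.nodup_ofFn.2 (ofFinEmbEquiv.symm s).injective)
    rw [← hγ.quantize_ιMulti_family k hu, ← exteriorPower.basis_apply, List.length_ofFn] at hsign
    have hmem : j ∈ List.ofFn (ofFinEmbEquiv.symm s) ↔ j ∈ s.val := by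
      rw [List.mem_ofFn]
      exact mem_range_ofFinEmbEquiv_symm_iff_mem s j
    simp only [hmem] at hsign
    rw [hsign, mul_assoc, mul_assoc, hγ (u j), ← Algebra.commutes, ← Algebra.smul_def,
      mul_smul_comm]
    by_cases hj : j ∈ s.val
    · simp only [hj, if_true]
      rw [show u.exteriorPower k s - (2 : K) • u.exteriorPower k s = -u.exteriorPower k s by
        rw [two_smul]; abel, map_neg, mul_comm, mul_smul, pow_succ, mul_neg_one]
      congr 1
      rcases neg_one_pow_eq_or K k with h | h <;> rcases Nat.even_or_odd k with h' | h' <;>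
        simp [h'.neg_one_pow]
    · simp only [hj, if_false]
      rw [smul_zero, sub_zero, add_zero, mul_comm, mul_smul]
      congr 1
      rcases Nat.even_or_odd k with h' | h' <;> simp [h'.neg_one_pow]
  exact LinearMap.congr_fun key ω

/-- In a monomial `k` indices contribute `-1` and the other `n - k` contribute `+1`. For `k = p` the
factor `n - 2k` is 0 if `n = 2p` and 1 if `n = 2p + 1`. -/
theorem IsCliffordMap.sum_conj_quantize [Fintype ι] {B : LinearMap.BilinForm K V}
    {γ : V →ₗ[K] A} (hγ : IsCliffordMap B γ) (hB : B.IsSymm) (u : Module.Basis ι K V)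
    (hu : ∀ i j, i ≠ j → B (u i) (u j) = 0) (hu0 : ∀ i, B (u i) (u i) ≠ 0) (ω : ⋀[K]^k V) :
    ∑ j, (B (u j) (u j))⁻¹ • (γ (u j) * hγ.quantize k ω * γ (u j)) =
      ((-1) ^ k * (Fintype.card ι - 2 * k) : K) • hγ.quantize k ω := by
  have (j : ι) : (B (u j) (u j))⁻¹ • (γ (u j) * hγ.quantize k ω * γ (u j)) =
      ((-1) ^ k : K) • hγ.quantize k (ω - (2 : K) • indexProjection k u j ω) := by
    rw [hγ.conj_quantize k hB u hu, smul_smul, mul_comm ((-1) ^ k), inv_mul_cancel_left₀ (hu0 j)]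
  simp only [this]
  rw [← Finset.smul_sum, ← map_sum, Finset.sum_sub_distrib, ← Finset.smul_sum,
    sum_indexProjection, mul_smul, ← map_smul _ (_ - _)]
  simp [sub_smul, mul_smul, Nat.cast_smul_eq_nsmul]

-- Conjugation by `γ(uⱼ)` shows that the kernel is stable under index projections. These isolate a
-- single monomial, whose image is a product of units. Hence the representation need not be faithful
-- on the whole Clifford algebra, as the spin module in odd dimension is not.
open Set.powersetCard in
theorem IsCliffordMap.quantize_injective [Nontrivial A] {B : LinearMap.BilinForm K V}
    {γ : V →ₗ[K] A} (hγ : IsCliffordMap B γ) (h2 : (2 : K) ≠ 0) (hB : B.IsSymm)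
    (u : Module.Basis ι K V) (hu : ∀ i j, i ≠ j → B (u i) (u j) = 0)
    (hu0 : ∀ i, B (u i) (u i) ≠ 0) : Function.Injective (hγ.quantize k) := by
  rw [injective_iff_map_eq_zero]
  intro ω hω
  have step (j : ι) {ω : ⋀[K]^k V} (h : hγ.quantize k ω = 0) :
      hγ.quantize k (indexProjection k u j ω) = 0 := by
    have := hγ.conj_quantize k hB u hu j ω
    rw [h, map_sub, h, mul_zero, zero_mul, zero_sub, smul_neg, zero_eq_neg, map_smul, smul_smul,
      smul_eq_zero] at this
    refine this.resolve_left (mul_ne_zero (mul_ne_zero ?_ (hu0 j)) h2)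
    exact pow_ne_zero _ (by simp)
  refine (u.exteriorPower k).ext_elem fun t => ?_
  rw [map_zero, Finsupp.zero_apply]
  -- Projecting along all indices of `t` keeps only the monomials `s ⊇ t`, that is, `t` alone, as
  -- the cardinalities agree.
  have iter (l : List ι) : ∃ ω', hγ.quantize k ω' = 0 ∧ ∀ s,
      (u.exteriorPower k).repr ω' s =
        if ∀ j ∈ l, j ∈ s.val then (u.exteriorPower k).repr ω s else 0 := by
    induction l with
    | nil => exact ⟨ω, hω, by simp⟩
    | cons j l ih =>
      obtain ⟨ω', h0, h1⟩ := ih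
      refine ⟨indexProjection k u j ω', step j h0, fun s => ?_⟩
      rw [indexProjection_repr, h1]
      by_cases hj : j ∈ s.val <;> simp [hj]
  obtain ⟨ω', h0, h1⟩ := iter t.val.toList
  have hω' : ω' = (u.exteriorPower k).repr ω t • u.exteriorPower k t := by
    refine (u.exteriorPower k).ext_elem fun s => ?_
    rw [h1, map_smul, Module.Basis.repr_self, Finsupp.smul_apply]
    by_cases hst : s = t
    · subst hst
      simp
    · rw [Finsupp.single_eq_of_ne hst, smul_zero, if_neg]
      intro h
      apply hst
      refine Subtype.ext (Finset.eq_of_subset_of_card_le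
        (fun j hj => h j (by simpa using hj)) ?_).symm
      rw [s.prop, t.prop]
  rw [hω', map_smul, smul_eq_zero] at h0
  refine h0.resolve_right ?_
  rw [exteriorPower.basis_apply, hγ.quantize_ιMulti_family k hu]
  suffices ∀ l : List ι, IsUnit (l.map fun i => γ (u i)).prod from (this _).ne_zero
  intro l
  induction l with
  | nil => simp
  | cons a l ih =>
    rw [List.map_cons, List.prod_cons]
    refine IsUnit.mul ?_ ih
    have hq := (hu0 a).isUnit.map (algebraMap K A)
    rw [← hγ] at hq
    exact ((Commute.refl (γ (u a))).isUnit_mul_iff.1 hq).1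

end OrthogonalBasis

/-! ### Isotropic subspaces and reflections. -/

section Isotropic

variable {K V : Type*} [Field K] [AddCommGroup V] [Module K V]

/-- A subspace on which the bilinear form vanishes identically. -/
def IsTotallyIsotropic (B : LinearMap.BilinForm K V) (N : Submodule K V) : Prop :=
  ∀ u ∈ N, ∀ v ∈ N, B u v = 0

theorem IsTotallyIsotropic.two_mul_finrank_le [FiniteDimensional K V]
    {B : LinearMap.BilinForm K V} {N : Submodule K V} (hN : IsTotallyIsotropic B N)
    (hB : B.Nondegenerate) : 2 * Module.finrank K N ≤ Module.finrank K V := by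
  have h1 : N ≤ B.orthogonal N := fun v hv u hu => hN u hu v hv
  have h2 := Submodule.finrank_mono h1
  rw [LinearMap.BilinForm.finrank_orthogonal hB] at h2
  have := Submodule.finrank_le N
  omega

theorem isTotallyIsotropic_span {B : LinearMap.BilinForm K V} {s : Set V}
    (h : ∀ u ∈ s, ∀ v ∈ s, B u v = 0) : IsTotallyIsotropic B (Submodule.span K s) := by
  intro u hu v hv
  induction hu, hv using Submodule.span_induction₂ with
  | mem_mem x y hx hy => exact h x hx y hy
  | zero_left y hy => simp
  | zero_right x hx => simp
  | add_left x y z _ _ _ h1 h2 => simp [h1, h2]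
  | add_right x y z _ _ _ h1 h2 => simp [h1, h2]
  | smul_left r x y _ _ h => simp [h]
  | smul_right r x y _ _ h => simp [h]

/-- The negative of the reflection in `u`, scaled by `B(u, u)` so as to be polynomial in `u`. -/
def scaledReflection (B : LinearMap.BilinForm K V) (u : V) : V →ₗ[K] V :=
  (2 : K) • (B u).smulRight u - B u u • LinearMap.id

theorem scaledReflection_apply (B : LinearMap.BilinForm K V) (u v : V) :
    scaledReflection B u v = (2 * B u v) • u - B u u • v := by
  simp [scaledReflection, mul_smul]

theorem scaledReflection_scaledReflection (B : LinearMap.BilinForm K V) (u v : V) :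
    scaledReflection B u (scaledReflection B u v) = (B u u * B u u) • v := by
  simp only [scaledReflection_apply, map_sub, map_smul]
  module

theorem bilin_scaledReflection {B : LinearMap.BilinForm K V} (hB : B.IsSymm) (u v w : V) :
    B (scaledReflection B u v) (scaledReflection B u w) = B u u * B u u * B v w := by
  simp only [scaledReflection_apply, map_sub, map_smul, smul_eq_mul, LinearMap.sub_apply,
    LinearMap.smul_apply]
  rw [show B v u = B u v from hB.eq v u]
  ring

theorem scaledReflection_injective {B : LinearMap.BilinForm K V} {u : V} (hu : B u u ≠ 0) :
    Function.Injective (scaledReflection B u) := by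
  intro v w h
  have := congrArg (scaledReflection B u) h
  rw [scaledReflection_scaledReflection, scaledReflection_scaledReflection] at this
  exact smul_right_injective V (mul_ne_zero hu hu) this

theorem IsTotallyIsotropic.map_scaledReflection {B : LinearMap.BilinForm K V} (hB : B.IsSymm)
    {N : Submodule K V} (hN : IsTotallyIsotropic B N) (u : V) :
    IsTotallyIsotropic B (N.map (scaledReflection B u)) := by
  rintro _ ⟨v, hv, rfl⟩ _ ⟨w, hw, rfl⟩
  rw [bilin_scaledReflection hB, hN v hv w hw, mul_zero]

/-- Reflections become conjugations in the Clifford algebra: replace `γ u * γ v` by `2 B(u, v) - γ v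
* γ u` and use `γ(u)² = B(u, u)`. This is why the scaled negative reflection is used. -/
theorem IsCliffordMap.map_scaledReflection {A : Type*} [Ring A] [Algebra K A]
    {B : LinearMap.BilinForm K V} (hB : B.IsSymm) {γ : V →ₗ[K] A} (hγ : IsCliffordMap B γ)
    (u v : V) : γ (scaledReflection B u v) = γ u * γ v * γ u := by
  have h := hγ.anticomm hB u v
  rw [eq_sub_of_add_eq h, sub_mul, mul_assoc (γ v), hγ u, ← Algebra.smul_def,
    ← Algebra.commutes, ← Algebra.smul_def, scaledReflection_apply, map_sub, map_smul, map_smul]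

/-- The composition of the scaled reflections in the vectors of a list. -/
def scaledReflections (B : LinearMap.BilinForm K V) : List V → (V →ₗ[K] V)
  | [] => LinearMap.id
  | u :: l => scaledReflections B l ∘ₗ scaledReflection B u

theorem bilin_scaledReflections_eq_zero {B : LinearMap.BilinForm K V} (hB : B.IsSymm) (l : List V)
    {v w : V} (h : B v w = 0) : B (scaledReflections B l v) (scaledReflections B l w) = 0 := by
  induction l generalizing v w with
  | nil => exact h
  | cons u l ih => exact ih (by rw [bilin_scaledReflection hB, h, mul_zero])

theorem scaledReflections_injective {B : LinearMap.BilinForm K V} (l : List V)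
    (hl : ∀ u ∈ l, B u u ≠ 0) : Function.Injective (scaledReflections B l) := by
  induction l with
  | nil => exact Function.injective_id
  | cons u l ih =>
    exact (ih fun w hw => hl w (by simp [hw])).comp (scaledReflection_injective (hl u (by simp)))

/-- Two totally isotropic subspaces of maximal dimension are related by reflections. -/
theorem exists_map_scaledReflections_eq [FiniteDimensional K V] {B : LinearMap.BilinForm K V}
    (h2 : (2 : K) ≠ 0) (hB : B.IsSymm) {p : ℕ}
    (hmax : ∀ N : Submodule K V, IsTotallyIsotropic B N → Module.finrank K N ≤ p)
    {N₁ N₂ : Submodule K V} (h₁ : IsTotallyIsotropic B N₁) (h₂ : IsTotallyIsotropic B N₂)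
    (hd₁ : Module.finrank K N₁ = p) (hd₂ : Module.finrank K N₂ = p) :
    ∃ l : List V, (∀ u ∈ l, B u u ≠ 0) ∧ N₁.map (scaledReflections B l) = N₂ := by
  induction hm : p - Module.finrank K (N₁ ⊓ N₂ : Submodule K V) using Nat.strong_induction_on
    generalizing N₁ with
  | _ m ih =>
  by_cases hle : N₁ ≤ N₂
  · refine ⟨[], by simp, ?_⟩
    rw [scaledReflections, Submodule.map_id]
    exact Submodule.eq_of_le_of_finrank_eq hle (hd₁.trans hd₂.symm)
  obtain ⟨x, hx1, hx2⟩ := SetLike.not_le_iff_exists.1 hle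
  -- Otherwise `N₂ + K x` would be a larger totally isotropic subspace.
  obtain ⟨y, hy2, hxy⟩ : ∃ y ∈ N₂, B x y ≠ 0 := by
    by_contra! hcon
    have hiso : IsTotallyIsotropic B (N₂ ⊔ K ∙ x) := by
      rw [← Submodule.span_eq N₂, ← Submodule.span_union]
      refine isTotallyIsotropic_span ?_
      rintro u (hu | rfl) v (hv | rfl)
      · exact h₂ u hu v hv
      · exact (hB.eq u v).trans (hcon u hu)
      · exact hcon v hv
      · exact h₁ _ hx1 _ hx1
    have hlt : N₂ < N₂ ⊔ K ∙ x := by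
      refine lt_of_le_of_ne le_sup_left fun h => hx2 ?_
      rw [h]
      exact Submodule.mem_sup_right (Submodule.mem_span_singleton_self x)
    have := Submodule.finrank_lt_finrank_of_lt hlt
    have := hmax _ hiso
    omega
  have hxx := h₁ x hx1 x hx1
  have hyy := h₂ y hy2 y hy2
  have hyx : B y x = B x y := hB.eq y x
  have hq : B (x - y) (x - y) = -(2 * B x y) := by
    simp only [map_sub, LinearMap.sub_apply, hxx, hyy, hyx]; ring
  have hq0 : B (x - y) (x - y) ≠ 0 := by
    rw [hq]; exact neg_ne_zero.2 (mul_ne_zero h2 hxy)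
  -- Up to scalars, the reflection in `x - y` carries `x` to `y` and fixes `N₁ ⊓ N₂`, so the
  -- intersection with `N₂` grows strictly.
  set N := N₁.map (scaledReflection B (x - y)) with hN
  have hle' : N₁ ⊓ N₂ ≤ N ⊓ N₂ := by
    rintro z ⟨hz1, hz2⟩
    refine ⟨⟨(-(B (x - y) (x - y))⁻¹) • z, N₁.smul_mem _ hz1, ?_⟩, hz2⟩
    have hz : B (x - y) z = 0 := by
      rw [map_sub, LinearMap.sub_apply, h₁ x hx1 z hz1, h₂ y hy2 z hz2, sub_zero]
    rw [map_smul, scaledReflection_apply, hz, mul_zero, zero_smul, zero_sub, smul_neg, neg_smul,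
      neg_neg, smul_smul, inv_mul_cancel₀ hq0, one_smul]
  have hyN : y ∈ N := by
    refine ⟨(2 * B x y)⁻¹ • x, N₁.smul_mem _ hx1, ?_⟩
    have : B (x - y) x = -B x y := by simp only [map_sub, LinearMap.sub_apply, hxx, hyx]; ring
    rw [map_smul, scaledReflection_apply, this, hq]
    have : (2 * -B x y) • (x - y) - -(2 * B x y) • x = (2 * B x y) • y := by module
    rw [this, smul_smul, inv_mul_cancel₀ (mul_ne_zero h2 hxy), one_smul]
  have hlt : N₁ ⊓ N₂ < N ⊓ N₂ := by
    refine lt_of_le_of_ne hle' fun h => hxy ?_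
    have : y ∈ N₁ ⊓ N₂ := h ▸ ⟨hyN, hy2⟩
    exact h₁ x hx1 y this.1
  have hdN : Module.finrank K N = p := by
    rw [hN, ← hd₁]
    exact (Submodule.equivMapOfInjective _ (scaledReflection_injective hq0) N₁).finrank_eq.symm
  have hrank := Submodule.finrank_lt_finrank_of_lt hlt
  have hrank' := Submodule.finrank_mono (inf_le_right : N ⊓ N₂ ≤ N₂)
  obtain ⟨l, hl, hlN⟩ := ih (p - Module.finrank K (N ⊓ N₂ : Submodule K V)) (by omega)
    (h₁.map_scaledReflection hB _) hdN rfl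
  refine ⟨(x - y) :: l, ?_, ?_⟩
  · intro u hu
    rcases List.mem_cons.1 hu with rfl | hu
    · exact hq0
    · exact hl u hu
  · rw [scaledReflections, Submodule.map_comp]
    exact hlN

/-- An even list of anisotropic vectors can be replaced by one of the same length whose
reflections cancel in pairs. -/
theorem exists_scaledReflections_eq_smul (B : LinearMap.BilinForm K V) :
    ∀ l : List V, Even l.length → (∀ u ∈ l, B u u ≠ 0) →
      ∃ (l' : List V) (c : K), l'.length = l.length ∧ c ≠ 0 ∧
        scaledReflections B l' = c • LinearMap.id
  | [], _, _ => ⟨[], 1, rfl, one_ne_zero, by rw [one_smul]; rfl⟩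
  | [_], h, _ => by simp at h
  | u :: w :: l, h, hl => by
    obtain ⟨l', c, hlen, hc, hl'⟩ := exists_scaledReflections_eq_smul B l
      (by simpa [Nat.even_add_one] using h) fun v hv => hl v (by simp [hv])
    have hu := hl u (by simp)
    -- The pair `u, w` is replaced by `u, u`, whose two scaled reflections compose to the scalar
    -- `B(u, u)²`.
    refine ⟨u :: u :: l', c * (B u u * B u u), by simp [hlen],
      mul_ne_zero hc (mul_ne_zero hu hu), ?_⟩
    ext v
    simp only [scaledReflections, LinearMap.comp_apply, hl', scaledReflection_scaledReflection,
      LinearMap.smul_apply, LinearMap.id_apply, smul_smul]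

end Isotropic

/-! ### Zariski topology and irreducibility. -/

section Zariski

variable {K M : Type*} [Field K] [AddCommGroup M] [Module K M]

theorem zariski_isClosed_iff {Z : Set M} : @IsClosed M (zariskiTopology K M) Z ↔
    ∃ S : Set (M → K), S ⊆ polyFunctions K M ∧ Z = zeroLocus S := by
  rw [← @isOpen_compl_iff M Z (zariskiTopology K M)]
  change Zᶜᶜ ∈ _ ↔ _
  rw [compl_compl]
  rfl

theorem linear_mem_polyFunctions (l : Module.Dual K M) : (l : M → K) ∈ polyFunctions K M :=
  Algebra.subset_adjoin ⟨l, rfl⟩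

/-- The polynomial functions in one variable. -/
noncomputable def linePolynomials (K : Type*) [Field K] : Subalgebra K (K → K) :=
  (Polynomial.aeval (id : K → K) : Polynomial K →ₐ[K] (K → K)).range

theorem mem_linePolynomials_iff {f : K → K} :
    f ∈ linePolynomials K ↔ ∃ P : Polynomial K, ∀ t, f t = P.eval t := by
  have key (P : Polynomial K) (t : K) : Polynomial.aeval (id : K → K) P t = P.eval t := by
    have := Polynomial.aeval_algHom_apply (Pi.evalAlgHom K (fun _ : K => K) t) id P
    exact this.symm.trans (Polynomial.coe_aeval_eq_eval t ▸ rfl)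
  constructor
  · rintro ⟨P, rfl⟩
    exact ⟨P, key P⟩
  · rintro ⟨P, hP⟩
    exact ⟨P, funext fun t => (key P t).trans (hP t).symm⟩

/-- A curve in a vector space all of whose coordinates are polynomials in the parameter. -/
def IsPolynomialCurve (κ : K → M) : Prop :=
  ∀ l : Module.Dual K M, (fun t => l (κ t)) ∈ linePolynomials K

theorem IsPolynomialCurve.comp_mem {κ : K → M} (hκ : IsPolynomialCurve κ) {f : M → K}
    (hf : f ∈ polyFunctions K M) : (fun t => f (κ t)) ∈ linePolynomials K := by
  induction hf using Algebra.adjoin_induction with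
  | mem f hf => obtain ⟨l, rfl⟩ := hf; exact hκ l
  | algebraMap r => exact (linePolynomials K).algebraMap_mem r
  | add f g _ _ hf hg => exact add_mem hf hg
  | mul f g _ _ hf hg => exact mul_mem hf hg

theorem isIrreducible_iff_closed_cover {M : Type*} [TopologicalSpace M] {X : Set M} :
    IsIrreducible X ↔ X.Nonempty ∧ ∀ A B : Set M, IsClosed A → IsClosed B → X ⊆ A ∪ B → X ⊆ A ∨ X ⊆ B := by
  rw [IsIrreducible, isPreirreducible_iff_isClosed_union_isClosed]

/-- If the curve lay in neither closed set, two nonzero polynomials would have a product vanishing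
on all of the infinite field `K`. -/
theorem IsPolynomialCurve.isIrreducible_range [Infinite K] {κ : K → M}
    (hκ : IsPolynomialCurve κ) : @IsIrreducible M (zariskiTopology K M) (Set.range κ) := by
  let _ := zariskiTopology K M
  rw [isIrreducible_iff_closed_cover]
  refine ⟨Set.range_nonempty κ, fun A B hA hB hAB => ?_⟩
  obtain ⟨S, hS, rfl⟩ := (zariski_isClosed_iff (K := K)).1 hA
  obtain ⟨T, hT, rfl⟩ := (zariski_isClosed_iff (K := K)).1 hB
  by_contra! hcon
  obtain ⟨⟨_, ⟨a, rfl⟩, ha⟩, ⟨_, ⟨b, rfl⟩, hb⟩⟩ :=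
    And.intro (Set.not_subset.1 hcon.1) (Set.not_subset.1 hcon.2)
  simp only [zeroLocus, Set.mem_ofPred_eq, not_forall] at ha hb
  obtain ⟨f, hf, hfa⟩ := ha
  obtain ⟨g, hg, hgb⟩ := hb
  obtain ⟨P, hP⟩ := mem_linePolynomials_iff.1 (hκ.comp_mem (hS hf))
  obtain ⟨Q, hQ⟩ := mem_linePolynomials_iff.1 (hκ.comp_mem (hT hg))
  have hPQ : P * Q = 0 := by
    refine Polynomial.funext fun t => ?_
    rw [Polynomial.eval_mul, Polynomial.eval_zero, ← hP, ← hQ]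
    rcases hAB ⟨t, rfl⟩ with h | h
    · rw [h f hf, zero_mul]
    · rw [h g hg, mul_zero]
  rcases mul_eq_zero.1 hPQ with h | h
  · exact hfa (by rw [hP, h, Polynomial.eval_zero])
  · exact hgb (by rw [hQ, h, Polynomial.eval_zero])

/-- Given a closed cover by `A` and `B`, a point outside `A` and one outside `B` cannot lie in a
common irreducible subset. -/
theorem isIrreducible_of_pairs {M : Type*} [TopologicalSpace M] {X : Set M} (hX : X.Nonempty)
    (h : ∀ x ∈ X, ∀ y ∈ X, ∃ T ⊆ X, IsIrreducible T ∧ x ∈ T ∧ y ∈ T) : IsIrreducible X := by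
  rw [isIrreducible_iff_closed_cover]
  refine ⟨hX, fun A B hA hB hAB => ?_⟩
  by_contra! hcon
  obtain ⟨⟨x, hx, hxA⟩, ⟨y, hy, hyB⟩⟩ :=
    And.intro (Set.not_subset.1 hcon.1) (Set.not_subset.1 hcon.2)
  obtain ⟨T, hTX, hT, hxT, hyT⟩ := h x hx y hy
  rcases (isIrreducible_iff_closed_cover.1 hT).2 A B hA hB (hTX.trans hAB) with h | h
  · exact hxA (h hxT)
  · exact hyB (h hyT)

theorem zariskiComponents_union {A B : Set M} (hA : @IsClosed M (zariskiTopology K M) A)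
    (hB : @IsClosed M (zariskiTopology K M) B) (hA' : @IsIrreducible M (zariskiTopology K M) A)
    (hB' : @IsIrreducible M (zariskiTopology K M) B) (hAB : ¬A ⊆ B) (hBA : ¬B ⊆ A) :
    zariskiComponents K (A ∪ B) = {A, B} := by
  let _ := zariskiTopology K M
  ext Z
  simp only [zariskiComponents, Set.mem_ofPred_eq, Set.mem_insert_iff, Set.mem_singleton_iff]
  constructor
  · rintro ⟨⟨hZ, hZi⟩, hmax⟩
    rcases (isIrreducible_iff_closed_cover.1 hZi).2 A B hA hB hZ with h | h
    · exact Or.inl (h.antisymm (hmax ⟨Set.subset_union_left, hA'⟩ h))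
    · exact Or.inr (h.antisymm (hmax ⟨Set.subset_union_right, hB'⟩ h))
  · rintro (rfl | rfl)
    · refine ⟨⟨Set.subset_union_left, hA'⟩, fun Y hY hle => ?_⟩
      rcases (isIrreducible_iff_closed_cover.1 hY.2).2 Z B hA hB hY.1 with h | h
      · exact h
      · exact absurd (hle.trans h) hAB
    · refine ⟨⟨Set.subset_union_right, hB'⟩, fun Y hY hle => ?_⟩
      rcases (isIrreducible_iff_closed_cover.1 hY.2).2 A Z hA hB hY.1 with h | h
      · exact absurd (hle.trans h) hBA
      · exact h

end Zariski

/-! ### Polynomial curves and their images under multilinear operations. -/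

section Curves

variable {K V : Type*} [Field K] [AddCommGroup V] [Module K V]

theorem const_mem_linePolynomials (a : K) : (fun _ => a) ∈ linePolynomials K :=
  (linePolynomials K).algebraMap_mem a

theorem isPolynomialCurve_const {M : Type*} [AddCommGroup M] [Module K M] (v : M) :
    IsPolynomialCurve fun _ : K => v :=
  fun l => const_mem_linePolynomials (l v)

theorem IsPolynomialCurve.sub {M : Type*} [AddCommGroup M] [Module K M] {κ κ' : K → M}
    (h : IsPolynomialCurve κ) (h' : IsPolynomialCurve κ') :
    IsPolynomialCurve fun t => κ t - κ' t := fun l => by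
  simpa only [map_sub] using! sub_mem (h l) (h' l)

theorem IsPolynomialCurve.add {M : Type*} [AddCommGroup M] [Module K M] {κ κ' : K → M}
    (h : IsPolynomialCurve κ) (h' : IsPolynomialCurve κ') :
    IsPolynomialCurve fun t => κ t + κ' t := fun l => by
  simpa only [map_add] using! add_mem (h l) (h' l)

theorem IsPolynomialCurve.smul {M : Type*} [AddCommGroup M] [Module K M] {f : K → K} {κ : K → M}
    (hf : f ∈ linePolynomials K) (h : IsPolynomialCurve κ) :
    IsPolynomialCurve fun t => f t • κ t := fun l => by
  simpa only [map_smul, smul_eq_mul] using! mul_mem hf (h l)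

theorem id_mem_linePolynomials : (fun t : K => t) ∈ linePolynomials K :=
  mem_linePolynomials_iff.2 ⟨Polynomial.X, by simp⟩

/-- The line through two points. -/
theorem isPolynomialCurve_lineMap {M : Type*} [AddCommGroup M] [Module K M] (a b : M) :
    IsPolynomialCurve fun t : K => (1 - t) • a + t • b :=
  (IsPolynomialCurve.smul (sub_mem (const_mem_linePolynomials 1) id_mem_linePolynomials)
    (isPolynomialCurve_const a)).add
    (IsPolynomialCurve.smul id_mem_linePolynomials (isPolynomialCurve_const b))

theorem IsPolynomialCurve.bilin [FiniteDimensional K V] (B : LinearMap.BilinForm K V)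
    {κ κ' : K → V} (h : IsPolynomialCurve κ) (h' : IsPolynomialCurve κ') :
    (fun t => B (κ t) (κ' t)) ∈ linePolynomials K := by
  set b := Module.finBasis K V
  have : (fun t => B (κ t) (κ' t)) =
      ∑ i, ∑ j, fun t => b.coord i (κ t) * b.coord j (κ' t) * B (b i) (b j) := by
    funext t
    conv_lhs => rw [← b.sum_repr (κ t), ← b.sum_repr (κ' t)]
    simp only [Finset.sum_apply, map_sum, LinearMap.sum_apply, map_smul, LinearMap.smul_apply,
      smul_eq_mul, Module.Basis.coord_apply, mul_assoc, Finset.mul_sum]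
    rw [Finset.sum_comm]
    exact Finset.sum_congr rfl fun i _ => Finset.sum_congr rfl fun j _ => by ring
  rw [this]
  exact sum_mem fun i _ => sum_mem fun j _ => mul_mem (mul_mem (h _) (h' _))
    (const_mem_linePolynomials _)

theorem IsPolynomialCurve.scaledReflections [FiniteDimensional K V]
    (B : LinearMap.BilinForm K V) (l : List (K → V)) (hl : ∀ u ∈ l, IsPolynomialCurve u)
    {κ : K → V} (h : IsPolynomialCurve κ) :
    IsPolynomialCurve fun t => scaledReflections B (l.map fun u => u t) (κ t) := by
  induction l generalizing κ with
  | nil => exact h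
  | cons u l ih =>
    refine ih (fun w hw => hl w (by simp [hw])) (κ := fun t => scaledReflection B (u t) (κ t)) ?_
    have hu := hl u (by simp)
    simp only [scaledReflection_apply]
    exact (IsPolynomialCurve.smul (mul_mem (const_mem_linePolynomials 2) (hu.bilin B h)) hu).sub
      (IsPolynomialCurve.smul (hu.bilin B hu) h)

theorem IsPolynomialCurve.ιMulti [FiniteDimensional K V] {k : ℕ} {κ : Fin k → K → V}
    (h : ∀ i, IsPolynomialCurve (κ i)) :
    IsPolynomialCurve fun t => exteriorPower.ιMulti K k fun i => κ i t := by
  intro l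
  set b := Module.finBasis K V
  have : (fun t => l (exteriorPower.ιMulti K k fun i => κ i t)) =
      ∑ r : Fin k → Fin (Module.finrank K V), fun t =>
        (∏ i, b.coord (r i) (κ i t)) * l (exteriorPower.ιMulti K k fun i => b (r i)) := by
    funext t
    have h1 : (fun i => κ i t) = fun i => ∑ j, b.coord j (κ i t) • b j :=
      funext fun i => (b.sum_repr (κ i t)).symm
    have h2 := (exteriorPower.ιMulti K k (M := V)).toMultilinearMap.map_sum
      fun i j => b.coord j (κ i t) • b j
    rw [h1, Finset.sum_apply]
    erw [h2]
    rw [map_sum]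
    refine Finset.sum_congr rfl fun r _ => ?_
    erw [MultilinearMap.map_smul_univ]
    rw [map_smul, smul_eq_mul]
    rfl
  rw [this]
  refine sum_mem fun r _ => mul_mem ?_ (const_mem_linePolynomials _)
  have := prod_mem (S := linePolynomials K) (t := Finset.univ)
    (f := fun i : Fin k => fun t => b.coord (r i) (κ i t)) fun i _ => h i _
  convert this using 1
  funext t
  simp

end Curves

/-! ### Matrices of rank at most one. -/

section RankOne

variable {K I : Type*} [Field K]

/-- All `2 × 2` minors vanish. -/
def MinorsVanish (M : Matrix I I K) : Prop :=
  ∀ i j k l, M i j * M k l = M i l * M k j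

theorem minorsVanish_vecMulVec (s φ : I → K) : MinorsVanish (Matrix.vecMulVec s φ) := by
  intro i j k l
  simp only [Matrix.vecMulVec_apply]
  ring

theorem MinorsVanish.exists_eq_vecMulVec {M : Matrix I I K} (h : MinorsVanish M) :
    ∃ s φ : I → K, M = Matrix.vecMulVec s φ := by
  by_cases h0 : M = 0
  · exact ⟨0, 0, by simp [h0]⟩
  obtain ⟨k, l, hkl⟩ : ∃ k l, M k l ≠ 0 := by
    by_contra! hcon
    exact h0 (Matrix.ext hcon)
  -- Column `l`, and row `k` divided by the nonzero pivot `M k l`.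
  refine ⟨fun i => M i l, fun j => (M k l)⁻¹ * M k j, ?_⟩
  ext i j
  rw [Matrix.vecMulVec_apply, mul_left_comm, ← h i j k l, mul_comm (M i j),
    inv_mul_cancel_left₀ hkl]

open Matrix in
theorem mulVec_col_eq_zero [Fintype I] {M P : Matrix I I K} (h : M * P = 0) (j : I) :
    (M *ᵥ fun i => P i j) = 0 := by
  funext i
  exact congrFun (congrFun h i) j

open Matrix in
theorem vecMul_row_eq_zero [Fintype I] {M P : Matrix I I K} (h : P * M = 0) (i : I) :
    P i ᵥ* M = 0 := by
  funext j
  exact congrFun (congrFun h i) j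

end RankOne

/-! ### Elementary facts on decomposable vectors. -/

section ExteriorFacts

variable {K V : Type*} [Field K] [AddCommGroup V] [Module K V]

/-- A left inverse of the inclusion of coordinates, followed by the determinant, takes the value 1
on the wedge. -/
theorem ιMulti_ne_zero_of_linearIndependent {k : ℕ} {v : Fin k → V}
    (hv : LinearIndependent K v) : exteriorPower.ιMulti K k v ≠ 0 := by
  intro h
  obtain ⟨f, hf⟩ := LinearMap.exists_leftInverse_of_injective _
    (LinearMap.ker_eq_bot'.2 (linearIndependent_iff.1 hv))
  set f' : V →ₗ[K] (Fin k → K) := (Finsupp.linearEquivFunOnFinite K K (Fin k)).toLinearMap ∘ₗ f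
  have h1 := exteriorPower.alternatingMapLinearEquiv_apply_ιMulti
    ((Matrix.detRowAlternating (n := Fin k) (R := K)).compLinearMap f') v
  rw [h, map_zero, AlternatingMap.compLinearMap_apply] at h1
  have h2 : (fun i => f' (v i)) = (1 : Matrix (Fin k) (Fin k) K) := by
    funext i
    have := LinearMap.congr_fun hf (Finsupp.single i 1)
    simp only [LinearMap.comp_apply, Finsupp.linearCombination_single, one_smul,
      LinearMap.id_apply] at this
    ext j
    simp [f', this, Matrix.one_apply, Finsupp.single_apply]
  have h3 : Matrix.detRowAlternating (fun i => f' (v i)) = (1 : K) := by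
    rw [h2]; exact Matrix.det_one
  exact zero_ne_one (h1.trans h3)

/-- The scalar is absorbed by the first vector, so `k ≥ 1` is essential. -/
theorem smul_mem_isoGrassmannCone {B : LinearMap.BilinForm K V} {k : ℕ} (hk : 1 ≤ k) (c : K)
    {ω : ⋀[K]^k V} (h : ω ∈ isoGrassmannCone B k) : c • ω ∈ isoGrassmannCone B k := by
  obtain ⟨v, hv, rfl⟩ := h
  let i₀ : Fin k := ⟨0, hk⟩
  refine ⟨Function.update v i₀ (c • v i₀), fun i j => ?_, ?_⟩
  · simp only [Function.update_apply]
    split_ifs <;> simp [hv]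
  · rw [AlternatingMap.map_update_smul, Function.update_eq_self]

theorem zero_mem_isoGrassmannCone {B : LinearMap.BilinForm K V} {k : ℕ} (hk : 1 ≤ k) :
    0 ∈ isoGrassmannCone B k :=
  ⟨0, by simp, ((exteriorPower.ιMulti K k).map_coord_zero ⟨0, hk⟩ rfl).symm⟩

end ExteriorFacts

/-! ### Pure spinors and chirality under reflections. -/

section PureSpinors

open Matrix

variable {K V I : Type*} [Field K] [AddCommGroup V] [Module K V] [Fintype I] [DecidableEq I]

/-- The spinors, and the co-spinors, annihilated by `N` are unique up to scalars. -/
def HasPureSpinor (γ : V →ₗ[K] Matrix I I K) (N : Submodule K V) : Prop :=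
  (∃ s₀ : I → K, ∀ s : I → K, (∀ v ∈ N, γ v *ᵥ s = 0) → ∃ a : K, s = a • s₀) ∧
  ∃ φ₀ : I → K, ∀ φ : I → K, (∀ v ∈ N, φ ᵥ* γ v = 0) → ∃ a : K, φ = a • φ₀

/-- The spinors annihilated by `N` are eigenvectors of `Γ` with eigenvalue `ε`. -/
def HasChirality (γ : V →ₗ[K] Matrix I I K) (Γ : Matrix I I K) (ε : K) (N : Submodule K V) :
    Prop :=
  ∀ s : I → K, (∀ v ∈ N, γ v *ᵥ s = 0) → Γ *ᵥ s = ε • s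

variable {B : LinearMap.BilinForm K V} {γ : V →ₗ[K] Matrix I I K}

theorem IsCliffordMap.mulVec_mulVec (hγ : IsCliffordMap B γ) (u : V) (s : I → K) :
    γ u *ᵥ (γ u *ᵥ s) = B u u • s := by
  rw [Matrix.mulVec_mulVec, hγ u, Algebra.algebraMap_eq_smul_one, Matrix.smul_mulVec,
    Matrix.one_mulVec]

theorem IsCliffordMap.vecMul_vecMul (hγ : IsCliffordMap B γ) (u : V) (s : I → K) :
    (s ᵥ* γ u) ᵥ* γ u = B u u • s := by
  rw [Matrix.vecMul_vecMul, hγ u, Algebra.algebraMap_eq_smul_one, Matrix.vecMul_smul,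
    Matrix.vecMul_one]

theorem IsCliffordMap.mulVec_mulVec_eq_zero (hγ : IsCliffordMap B γ) (hB : B.IsSymm)
    {N : Submodule K V} {u : V} (hu : B u u ≠ 0) {s : I → K}
    (hs : ∀ v ∈ N.map (scaledReflection B u), γ v *ᵥ s = 0) (v : V) (hv : v ∈ N) :
    γ v *ᵥ (γ u *ᵥ s) = 0 := by
  have h := hs _ (Submodule.mem_map_of_mem hv)
  rw [hγ.map_scaledReflection hB, ← Matrix.mulVec_mulVec, ← Matrix.mulVec_mulVec] at h
  have h' := congrArg (γ u *ᵥ ·) h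
  simp only [Matrix.mulVec_zero] at h'
  rw [hγ.mulVec_mulVec] at h'
  exact (smul_eq_zero.1 h').resolve_left hu

theorem IsCliffordMap.vecMul_vecMul_eq_zero (hγ : IsCliffordMap B γ) (hB : B.IsSymm)
    {N : Submodule K V} {u : V} (hu : B u u ≠ 0) {φ : I → K}
    (hs : ∀ v ∈ N.map (scaledReflection B u), φ ᵥ* γ v = 0) (v : V) (hv : v ∈ N) :
    (φ ᵥ* γ u) ᵥ* γ v = 0 := by
  have h := hs _ (Submodule.mem_map_of_mem hv)
  rw [hγ.map_scaledReflection hB, ← Matrix.vecMul_vecMul, ← Matrix.vecMul_vecMul] at h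
  have h' := congrArg (· ᵥ* γ u) h
  simp only [Matrix.zero_vecMul] at h'
  rw [hγ.vecMul_vecMul] at h'
  exact (smul_eq_zero.1 h').resolve_left hu

/-- Since `γ(u)² = B(u, u) ≠ 0`, the operator `γ(u)` is invertible, and it carries spinors killed by
the reflected subspace to spinors killed by `N`. -/
theorem HasPureSpinor.map_scaledReflection (hγ : IsCliffordMap B γ) (hB : B.IsSymm)
    {N : Submodule K V} {u : V} (hu : B u u ≠ 0) (h : HasPureSpinor γ N) :
    HasPureSpinor γ (N.map (scaledReflection B u)) := by
  obtain ⟨⟨s₀, hs₀⟩, φ₀, hφ₀⟩ := h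
  constructor
  · refine ⟨γ u *ᵥ s₀, fun s hs => ?_⟩
    obtain ⟨a, ha⟩ := hs₀ _ (hγ.mulVec_mulVec_eq_zero hB hu hs)
    refine ⟨(B u u)⁻¹ * a, ?_⟩
    rw [mul_smul, ← Matrix.mulVec_smul, ← ha, hγ.mulVec_mulVec, smul_smul, inv_mul_cancel₀ hu,
      one_smul]
  · refine ⟨φ₀ ᵥ* γ u, fun φ hφ => ?_⟩
    obtain ⟨a, ha⟩ := hφ₀ _ (hγ.vecMul_vecMul_eq_zero hB hu hφ)
    refine ⟨(B u u)⁻¹ * a, ?_⟩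
    rw [mul_smul, ← Matrix.smul_vecMul, ← ha, hγ.vecMul_vecMul, smul_smul, inv_mul_cancel₀ hu,
      one_smul]

theorem HasPureSpinor.map_scaledReflections (hγ : IsCliffordMap B γ) (hB : B.IsSymm) (l : List V)
    (hl : ∀ u ∈ l, B u u ≠ 0) {N : Submodule K V} (h : HasPureSpinor γ N) :
    HasPureSpinor γ (N.map (scaledReflections B l)) := by
  induction l generalizing N with
  | nil => simpa [scaledReflections] using h
  | cons u l ih =>
    rw [scaledReflections, Submodule.map_comp]
    exact ih (fun v hv => hl v (by simp [hv])) (h.map_scaledReflection hγ hB (hl u (by simp)))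

/-- `Γ` anticommutes with `γ(u)`, which relates the spinors of `N` and of its reflection; each
reflection thus reverses chirality. -/
theorem HasChirality.map_scaledReflection (hγ : IsCliffordMap B γ) (hB : B.IsSymm)
    {Γ : Matrix I I K} (hΓ : ∀ v, Γ * γ v = -(γ v * Γ)) {ε : K}
    {N : Submodule K V} {u : V} (hu : B u u ≠ 0) (h : HasChirality γ Γ ε N) :
    HasChirality γ Γ (-ε) (N.map (scaledReflection B u)) := by
  intro s hs
  have h1 := h _ (hγ.mulVec_mulVec_eq_zero hB hu hs)
  rw [Matrix.mulVec_mulVec, hΓ, Matrix.neg_mulVec, ← Matrix.mulVec_mulVec] at h1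
  have h2 := congrArg (γ u *ᵥ ·) h1
  simp only [Matrix.mulVec_neg, Matrix.mulVec_smul] at h2
  rw [hγ.mulVec_mulVec, hγ.mulVec_mulVec, smul_comm, ← smul_neg] at h2
  have h3 := smul_right_injective _ hu h2
  rw [neg_smul, ← h3, neg_neg]

theorem HasChirality.map_scaledReflections (hγ : IsCliffordMap B γ) (hB : B.IsSymm)
    {Γ : Matrix I I K} (hΓ : ∀ v, Γ * γ v = -(γ v * Γ)) (l : List V)
    (hl : ∀ u ∈ l, B u u ≠ 0) {ε : K} {N : Submodule K V} (h : HasChirality γ Γ ε N) :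
    HasChirality γ Γ ((-1) ^ l.length * ε) (N.map (scaledReflections B l)) := by
  induction l generalizing N ε with
  | nil => simpa [scaledReflections] using h
  | cons u l ih =>
    rw [scaledReflections, Submodule.map_comp]
    have := ih (fun v hv => hl v (by simp [hv]))
      (h.map_scaledReflection hγ hB hΓ (hl u (by simp)))
    rwa [mul_neg, ← neg_mul, ← mul_neg_one, ← pow_succ] at this

theorem IsCliffordMap.mul_quantize_eq_zero (hγ : IsCliffordMap B γ) (hB : B.IsSymm) {k : ℕ}
    {n : Fin k → V} (hn : ∀ i j, B (n i) (n j) = 0) {v : V}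
    (hv : v ∈ Submodule.span K (Set.range n)) :
    γ v * hγ.quantize k (exteriorPower.ιMulti K k n) = 0 ∧
      hγ.quantize k (exteriorPower.ιMulti K k n) * γ v = 0 := by
  rw [hγ.quantize_ιMulti n fun i j _ => hn i j]
  set P := (List.ofFn fun i => γ (n i)).prod with hP
  have hsq : ∀ a ∈ List.ofFn fun i => γ (n i), a * a = 0 := by
    intro a ha
    obtain ⟨i, rfl⟩ := List.mem_ofFn.1 ha
    rw [hγ, hn, map_zero]
  have hac : ∀ a ∈ List.ofFn fun i => γ (n i), ∀ b ∈ List.ofFn fun i => γ (n i),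
      a * b = -(b * a) := by
    intro a ha b hb
    obtain ⟨i, rfl⟩ := List.mem_ofFn.1 ha
    obtain ⟨j, rfl⟩ := List.mem_ofFn.1 hb
    exact hγ.anticomm_of_ortho hB (hn i j)
  induction hv using Submodule.span_induction with
  | mem x hx =>
    obtain ⟨i, rfl⟩ := hx
    exact ⟨mul_list_prod_eq_zero _ hsq hac (List.mem_ofFn.2 ⟨i, rfl⟩),
      list_prod_mul_eq_zero _ hsq hac (List.mem_ofFn.2 ⟨i, rfl⟩)⟩
  | zero => simp
  | add x y _ _ hx hy => simp [add_mul, mul_add, hx, hy]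
  | smul c x _ hx => simp [hx]

/-- Every column of the symbol is killed by the span of `n`, hence is a multiple of `s₀`. -/
theorem IsCliffordMap.quantize_eq_vecMulVec (hγ : IsCliffordMap B γ) (hB : B.IsSymm) {k : ℕ}
    {n : Fin k → V} (hn : ∀ i j, B (n i) (n j) = 0) {s₀ : I → K}
    (hs₀ : ∀ s : I → K, (∀ v ∈ Submodule.span K (Set.range n), γ v *ᵥ s = 0) →
      ∃ a : K, s = a • s₀) :
    ∃ ψ : I → K, hγ.quantize k (exteriorPower.ιMulti K k n) = Matrix.vecMulVec s₀ ψ := by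
  choose ψ hψ using fun j => hs₀ _ fun v hv =>
    mulVec_col_eq_zero (hγ.mul_quantize_eq_zero hB hn hv).1 j
  refine ⟨ψ, ?_⟩
  ext i j
  rw [Matrix.vecMulVec_apply, mul_comm]
  exact congrFun (hψ j) i

theorem IsCliffordMap.mul_quantize_of_chirality (hγ : IsCliffordMap B γ) (hB : B.IsSymm) {k : ℕ}
    {n : Fin k → V} (hn : ∀ i j, B (n i) (n j) = 0) {Γ : Matrix I I K} {ε : K}
    (h : HasChirality γ Γ ε (Submodule.span K (Set.range n))) :
    Γ * hγ.quantize k (exteriorPower.ιMulti K k n) =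
      ε • hγ.quantize k (exteriorPower.ιMulti K k n) := by
  ext i j
  exact congrFun (h _ fun v hv => mulVec_col_eq_zero (hγ.mul_quantize_eq_zero hB hn hv).1 j) i

end PureSpinors

/-! ### Rank one symbols come from isotropic subspaces. -/

section ConeEquations

open Matrix

variable {K V I : Type*} [Field K] [AddCommGroup V] [Module K V] [Fintype I]
  {B : LinearMap.BilinForm K V} {γ : V →ₗ[K] Matrix I I K}

theorem finrank_span_range_of_ιMulti_ne_zero {k : ℕ} {n : Fin k → V}
    (h : exteriorPower.ιMulti K k n ≠ 0) :
    Module.finrank K (Submodule.span K (Set.range n)) = k := by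
  have : LinearIndependent K n := by
    by_contra hn
    exact h ((exteriorPower.ιMulti K k).map_linearDependent n hn)
  rw [finrank_span_eq_card this, Fintype.card_fin]

theorem IsCliffordMap.minorsVanish_of_mem_cone [DecidableEq I]
    (hγ : IsCliffordMap B γ) (hB : B.IsSymm) {p : ℕ}
    (hpure : ∀ N : Submodule K V, IsTotallyIsotropic B N → Module.finrank K N = p →
      HasPureSpinor γ N) {ω : ⋀[K]^p V} (hω : ω ∈ isoGrassmannCone B p) :
    MinorsVanish (hγ.quantize p ω) := by
  obtain ⟨n, hn, rfl⟩ := hω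
  by_cases h0 : exteriorPower.ιMulti K p n = 0
  · rw [h0, map_zero]
    intro i j k l
    simp
  obtain ⟨⟨s₀, hs₀⟩, -⟩ := hpure _ (isTotallyIsotropic_span (by
    rintro _ ⟨i, rfl⟩ _ ⟨j, rfl⟩
    exact hn i j)) (finrank_span_range_of_ιMulti_ne_zero h0)
  obtain ⟨ψ, hψ⟩ := hγ.quantize_eq_vecMulVec hB hn hs₀
  rw [hψ]
  exact minorsVanish_vecMulVec _ _

/-- The vectors annihilating a spinor. -/
def spinorAnnihilator (γ : V →ₗ[K] Matrix I I K) (s : I → K) : Submodule K V where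
  carrier := {v | γ v *ᵥ s = 0}
  add_mem' ha hb := by
    simp only [Set.mem_ofPred_eq, map_add, Matrix.add_mulVec] at *
    rw [ha, hb, add_zero]
  zero_mem' := by simp
  smul_mem' c v hv := by
    simp only [Set.mem_ofPred_eq, map_smul, Matrix.smul_mulVec] at *
    rw [hv, smul_zero]

theorem mem_spinorAnnihilator {s : I → K} {v : V} :
    v ∈ spinorAnnihilator γ s ↔ γ v *ᵥ s = 0 := Iff.rfl

/-- Apply `γ(u)γ(v) + γ(v)γ(u) = 2 B(u, v)` to `s ≠ 0`. -/
theorem IsCliffordMap.isTotallyIsotropic_spinorAnnihilator [DecidableEq I]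
    (hγ : IsCliffordMap B γ)
    (hB : B.IsSymm) (h2 : (2 : K) ≠ 0) {s : I → K} (hs : s ≠ 0) :
    IsTotallyIsotropic B (spinorAnnihilator γ s) := by
  intro u hu v hv
  rw [mem_spinorAnnihilator] at hu hv
  have h := congrArg (· *ᵥ s) (hγ.anticomm hB u v)
  simp only [Matrix.add_mulVec, ← Matrix.mulVec_mulVec, hu, hv, Matrix.mulVec_zero, add_zero,
    Algebra.algebraMap_eq_smul_one, Matrix.smul_mulVec, Matrix.one_mulVec] at h
  exact (mul_eq_zero.1 ((smul_eq_zero.1 h.symm).resolve_right hs)).resolve_left h2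

theorem IsCliffordMap.isTotallyIsotropic_of_vecMul_eq_zero [DecidableEq I]
    (hγ : IsCliffordMap B γ)
    (hB : B.IsSymm) (h2 : (2 : K) ≠ 0) {φ : I → K} (hφ : φ ≠ 0) {N : Submodule K V}
    (hN : ∀ v ∈ N, φ ᵥ* γ v = 0) : IsTotallyIsotropic B N := by
  intro u hu v hv
  have h := congrArg (φ ᵥ* ·) (hγ.anticomm hB u v)
  simp only [Matrix.vecMul_add, ← Matrix.vecMul_vecMul, hN u hu, hN v hv, Matrix.zero_vecMul,
    add_zero, Algebra.algebraMap_eq_smul_one, Matrix.vecMul_smul, Matrix.vecMul_one] at h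
  exact (mul_eq_zero.1 ((smul_eq_zero.1 h.symm).resolve_right hφ)).resolve_left h2

/-- The vector representing the linear form `v ↦ φ(γ(v) x)`. -/
noncomputable def spinorPairing {ι : Type*} [Fintype ι] (B : LinearMap.BilinForm K V)
    (γ : V →ₗ[K] Matrix I I K) (u : Module.Basis ι K V) (φ : I → K) : (I → K) →ₗ[K] V where
  toFun x := ∑ j, ((B (u j) (u j))⁻¹ * (φ ⬝ᵥ (γ (u j) *ᵥ x))) • u j
  map_add' x y := by
    simp [Matrix.mulVec_add, dotProduct_add, mul_add, add_smul, Finset.sum_add_distrib]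
  map_smul' c x := by
    simp [Matrix.mulVec_smul, dotProduct_smul, Finset.smul_sum, smul_smul, mul_left_comm]

theorem spinorPairing_apply {ι : Type*} [Fintype ι] (u : Module.Basis ι K V) (φ x : I → K) :
    spinorPairing B γ u φ x = ∑ j, ((B (u j) (u j))⁻¹ * (φ ⬝ᵥ (γ (u j) *ᵥ x))) • u j := rfl

theorem bilin_spinorPairing {ι : Type*} [Fintype ι] (u : Module.Basis ι K V)
    (hu : ∀ i j, i ≠ j → B (u i) (u j) = 0) (hu0 : ∀ i, B (u i) (u i) ≠ 0) (φ x : I → K) (v : V) :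
    B (spinorPairing B γ u φ x) v = φ ⬝ᵥ (γ v *ᵥ x) := by
  classical
  conv_rhs => rw [← u.sum_repr v]
  conv_lhs => rw [← u.sum_repr v]
  simp only [spinorPairing_apply, map_sum, LinearMap.sum_apply, map_smul, LinearMap.smul_apply,
    smul_eq_mul, Matrix.sum_mulVec, dotProduct_sum, Matrix.smul_mulVec, dotProduct_smul]
  refine Finset.sum_congr rfl fun i _ => ?_
  congr 1
  rw [Finset.sum_eq_single i]
  · rw [mul_right_comm, inv_mul_cancel₀ (hu0 i), one_mul]
  · intro j _ hj
    rw [hu j i hj, mul_zero]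
  · simp

/-- This is `sum_conj_quantize` applied to `s φᵀ` and evaluated at `x`: the `j`-th summand is `γ(uⱼ)
s` times `φ(γ(uⱼ) x) / B(uⱼ, uⱼ)`. -/
theorem IsCliffordMap.spinorPairing_mulVec [DecidableEq I] {ι : Type*} [Fintype ι] [LinearOrder ι]
    (hγ : IsCliffordMap B γ) (hB : B.IsSymm) (u : Module.Basis ι K V)
    (hu : ∀ i j, i ≠ j → B (u i) (u j) = 0) (hu0 : ∀ i, B (u i) (u i) ≠ 0) {k : ℕ}
    {ω : ⋀[K]^k V} {s φ : I → K} (hω : hγ.quantize k ω = vecMulVec s φ) (x : I → K) :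
    γ (spinorPairing B γ u φ x) *ᵥ s =
      ((-1) ^ k * (Fintype.card ι - 2 * k) * (φ ⬝ᵥ x) : K) • s := by
  have h := congrArg (· *ᵥ x) (hγ.sum_conj_quantize k hB u hu hu0 ω)
  simp only [hω, Matrix.sum_mulVec, Matrix.smul_mulVec, ← Matrix.mulVec_mulVec,
    Matrix.vecMulVec_mulVec] at h
  rw [mul_smul]
  have e : ∀ (a : K) (y : I → K), MulOpposite.op a • y = a • y := fun a y => by
    ext; simp [mul_comm]
  simp only [e, Matrix.mulVec_smul] at h
  rw [← h, spinorPairing_apply]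
  simp only [map_sum, map_smul, Matrix.sum_mulVec, Matrix.smul_mulVec, mul_smul]

theorem IsCliffordMap.mem_cone_of_minorsVanish [DecidableEq I] [Nonempty I]
    [FiniteDimensional K V] {ι : Type*} [Fintype ι]
    [LinearOrder ι] (hγ : IsCliffordMap B γ) (h2 : (2 : K) ≠ 0) (hB : B.IsSymm)
    (hB' : B.Nondegenerate) (u : Module.Basis ι K V)
    (hu : ∀ i j, i ≠ j → B (u i) (u j) = 0) {p : ℕ} (hp : 1 ≤ p)
    (hdim : Module.finrank K V = 2 * p ∨ Module.finrank K V = 2 * p + 1)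
    (hpure : ∀ N : Submodule K V, IsTotallyIsotropic B N → Module.finrank K N = p →
      HasPureSpinor γ N) {ω : ⋀[K]^p V} (hω : MinorsVanish (hγ.quantize p ω)) :
    ω ∈ isoGrassmannCone B p := by
  by_cases hω0 : ω = 0
  · rw [hω0]
    exact zero_mem_isoGrassmannCone hp
  have hu0 : ∀ i, B (u i) (u i) ≠ 0 :=
    LinearMap.BilinForm.iIsOrtho.not_isOrtho_basis_self_of_nondegenerate
      (fun i j hij => hu i j hij) hB'
  obtain ⟨s, φ, hsφ⟩ := hω.exists_eq_vecMulVec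
  have hinj := hγ.quantize_injective p h2 hB u hu hu0
  have hc0 : hγ.quantize p ω ≠ 0 := fun h => hω0 (hinj (h.trans (map_zero _).symm))
  have hs : s ≠ 0 := by
    rintro rfl
    exact hc0 (by rw [hsφ, Matrix.zero_vecMulVec])
  have hφ : φ ≠ 0 := by
    rintro rfl
    exact hc0 (by rw [hsφ, Matrix.vecMulVec_zero])
  have hw := hγ.spinorPairing_mulVec hB u hu hu0 hsφ
  have hBw := bilin_spinorPairing (γ := γ) u hu hu0 φ
  set w := spinorPairing B γ u φ
  set N := spinorAnnihilator γ s with hN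
  have hNiso : IsTotallyIsotropic B N := hγ.isTotallyIsotropic_spinorAnnihilator hB h2 hs
  have hle := hNiso.two_mul_finrank_le hB'
  have hcard : Fintype.card ι = Module.finrank K V := (Module.finrank_eq_card_basis u).symm
  -- the orthogonal complement of the range of `w` annihilates `φ`
  have horth : ∀ v ∈ B.orthogonal (LinearMap.range w), φ ᵥ* γ v = 0 := by
    intro v hv
    refine dotProduct_eq_zero _ fun x => ?_
    rw [← Matrix.dotProduct_mulVec, ← hBw]
    exact hv _ ⟨x, rfl⟩
  -- The orthogonal complement of the range of `w` kills `φ ≠ 0`, so it is isotropic and of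
  -- dimension at most `p`.
  have hdimw : Module.finrank K V - p ≤ Module.finrank K (LinearMap.range w) := by
    have h1 := (hγ.isTotallyIsotropic_of_vecMul_eq_zero hB h2 hφ horth).two_mul_finrank_le hB'
    rw [LinearMap.BilinForm.finrank_orthogonal hB'] at h1
    omega
  have hNp : Module.finrank K N = p := by
    suffices p ≤ Module.finrank K N by omega
    -- For `dim V = 2p` the eigenvalue is 0, so the range of `w` lies in `N`. For `dim V = 2p + 1`
    -- only `w (ker φ)` does, which costs at most one dimension; the range has dimension at least `p
    -- + 1` there.
    rcases hdim with hd | hd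
    · have hwN : LinearMap.range w ≤ N := by
        rintro _ ⟨x, rfl⟩
        rw [hN, mem_spinorAnnihilator, hw, hcard, hd]
        simp
      have := Submodule.finrank_mono hwN
      omega
    · obtain ⟨x₁, hx₁⟩ : ∃ x₁, φ ⬝ᵥ x₁ ≠ 0 := by
        by_contra! hcon
        exact hφ (dotProduct_eq_zero _ hcon)
      have hwN : LinearMap.range w ≤ N ⊔ K ∙ w x₁ := by
        rintro _ ⟨x, rfl⟩
        have hx : w (x - (φ ⬝ᵥ x * (φ ⬝ᵥ x₁)⁻¹) • x₁) ∈ N := by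
          rw [hN, mem_spinorAnnihilator, hw, dotProduct_sub, dotProduct_smul, smul_eq_mul,
            mul_assoc (φ ⬝ᵥ x), inv_mul_cancel₀ hx₁, mul_one, sub_self, mul_zero, zero_smul]
        rw [map_sub, map_smul] at hx
        have := Submodule.add_mem_sup hx (Submodule.smul_mem (K ∙ w x₁)
          (φ ⬝ᵥ x * (φ ⬝ᵥ x₁)⁻¹) (Submodule.mem_span_singleton_self _))
        rwa [sub_add_cancel] at this
      have h1 := Submodule.finrank_mono hwN
      have h2 := Submodule.finrank_add_le_finrank_add_finrank N (K ∙ w x₁)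
      have h3 : Module.finrank K (K ∙ w x₁) ≤ 1 := (finrank_span_le_card {w x₁}).trans (by simp)
      omega
  -- Apply the anticommutator of `γ(w x)` and `γ(v)` to `s`: as `γ(v) s = 0` and `γ(w x) s` is a
  -- multiple of `s`, it gives `2 B(w x, v) s = 0`.
  have hφN : ∀ v ∈ N, φ ᵥ* γ v = 0 := by
    intro v hv
    refine dotProduct_eq_zero _ fun x => ?_
    have hv' : γ v *ᵥ s = 0 := hv
    rw [← Matrix.dotProduct_mulVec, ← hBw]
    have h := congrArg (· *ᵥ s) (hγ.anticomm hB (w x) v)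
    simp only [Matrix.add_mulVec, ← Matrix.mulVec_mulVec, hv', hw, Matrix.mulVec_zero, zero_add,
      Algebra.algebraMap_eq_smul_one, Matrix.smul_mulVec, Matrix.one_mulVec, Matrix.mulVec_smul,
      smul_zero] at h
    exact (mul_eq_zero.1 ((smul_eq_zero.1 h.symm).resolve_right hs)).resolve_left h2
  obtain ⟨⟨s₀, hs₀⟩, φ₀, hφ₀⟩ := hpure N hNiso hNp
  obtain ⟨a, ha⟩ := hs₀ s fun v hv => hv
  obtain ⟨b, hb⟩ := hφ₀ φ hφN
  set n : Fin p → V := fun i => (Module.finBasisOfFinrankEq K N hNp i : V) with hn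
  have hnspan : Submodule.span K (Set.range n) = N := by
    rw [hn, show (fun i => (Module.finBasisOfFinrankEq K N hNp i : V)) =
      N.subtype ∘ Module.finBasisOfFinrankEq K N hNp from rfl, Set.range_comp,
      ← Submodule.map_span, Module.Basis.span_eq, Submodule.map_top, Submodule.range_subtype]
  have hnli : LinearIndependent K n :=
    (Module.finBasisOfFinrankEq K N hNp).linearIndependent.map' N.subtype N.ker_subtype
  have hniso : ∀ i j, B (n i) (n j) = 0 := fun i j => hNiso _ (Subtype.coe_prop _) _
    (Subtype.coe_prop _)
  obtain ⟨ψ, hψ⟩ := hγ.quantize_eq_vecMulVec hB hniso (s₀ := s₀) (by rw [hnspan]; exact hs₀)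
  obtain ⟨i, hi⟩ : ∃ i, s₀ i ≠ 0 := by
    by_contra! hcon
    exact hs (by rw [ha, funext hcon]; exact smul_zero a)
  -- The `i`-th row of the symbol of `n` is a nonzero multiple of `ψ` and is killed by `N` from the
  -- right.
  obtain ⟨m, hm⟩ := hφ₀ ψ fun v hv => by
    have h := vecMul_row_eq_zero (hγ.mul_quantize_eq_zero hB hniso (hnspan ▸ hv)).2 i
    rw [hψ] at h
    have h' : vecMulVec s₀ ψ i = s₀ i • ψ := rfl
    rw [h', Matrix.smul_vecMul] at h
    exact (smul_eq_zero.1 h).resolve_left hi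
  have hm0 : m ≠ 0 := by
    rintro rfl
    refine ιMulti_ne_zero_of_linearIndependent hnli (hinj ?_)
    rw [hψ, hm, zero_smul, Matrix.vecMulVec_zero, map_zero]
  have hfinal : ω = (a * b * m⁻¹) • exteriorPower.ιMulti K p n := by
    apply hinj
    rw [map_smul, hψ, hsφ, ha, hb, hm]
    ext i j
    simp only [vecMulVec_apply, Matrix.smul_apply, Pi.smul_apply, smul_eq_mul]
    field_simp
  rw [hfinal]
  exact smul_mem_isoGrassmannCone hp _ ⟨n, hniso, rfl⟩

end ConeEquations

/-! ### The spin representation on occupation numbers. -/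

section SpinModule

open Matrix

variable {K V : Type*} [Field K] [AddCommGroup V] [Module K V] {p : ℕ}

/-- Change the `i`-th occupation number. -/
def flipAt (T : Fin p → Bool) (i : Fin p) : Fin p → Bool := Function.update T i (!T i)

theorem flipAt_same (T : Fin p → Bool) (i : Fin p) : flipAt T i i = !T i := by simp [flipAt]

theorem flipAt_of_ne (T : Fin p → Bool) {i j : Fin p} (h : j ≠ i) : flipAt T i j = T j := by
  simp [flipAt, h]

theorem flipAt_flipAt (T : Fin p → Bool) (i : Fin p) : flipAt (flipAt T i) i = T := by
  simp [flipAt]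

theorem flipAt_comm (T : Fin p → Bool) {i j : Fin p} (h : i ≠ j) :
    flipAt (flipAt T i) j = flipAt (flipAt T j) i := by
  rw [flipAt, flipAt_of_ne T h.symm, flipAt, flipAt, flipAt_of_ne T h, flipAt,
    Function.update_comm h]

theorem eq_flipAt_iff {S T : Fin p → Bool} {i : Fin p} : S = flipAt T i ↔ T = flipAt S i := by
  constructor <;> rintro rfl <;> rw [flipAt_flipAt]

/-- The sign `(-1)ᵐ`, where `m` is the number of occupied places in `F`. -/
def occupationSign (K : Type*) [Field K] (F : Finset (Fin p)) (T : Fin p → Bool) : K :=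
  ∏ j ∈ F, if T j then -1 else 1

theorem occupationSign_flipAt (F : Finset (Fin p)) (T : Fin p → Bool) (i : Fin p) :
    occupationSign K F (flipAt T i) =
      if i ∈ F then -occupationSign K F T else occupationSign K F T := by
  have h (G : Finset (Fin p)) (hG : i ∉ G) :
      occupationSign K G (flipAt T i) = occupationSign K G T := by
    refine Finset.prod_congr rfl fun j hj => ?_
    rw [flipAt_of_ne T (ne_of_mem_of_not_mem hj hG)]
  split_ifs with hi
  · rw [← Finset.insert_erase hi]
    have h' := h (F.erase i) (Finset.notMem_erase i F)
    simp only [occupationSign] at h' ⊢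
    rw [Finset.prod_insert (Finset.notMem_erase i F), Finset.prod_insert
      (Finset.notMem_erase i F), h', flipAt_same]
    cases T i <;> simp
  · exact h F hi

theorem occupationSign_mul_self (F : Finset (Fin p)) (T : Fin p → Bool) :
    occupationSign K F T * occupationSign K F T = 1 := by
  rw [occupationSign, ← Finset.prod_mul_distrib]
  refine Finset.prod_eq_one fun j _ => ?_
  split_ifs <;> simp

/-- The coordinate form attached to a place and an occupation number. -/
def hyperbolicCoord (x y : Fin p → Module.Dual K V) (i : Fin p) (b : Bool) : Module.Dual K V :=
  if b then x i else y i

/-- The spin representation attached to hyperbolic coordinates `x`, `y` and a further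
coordinate `z`. -/
def spinMap (x y : Fin p → Module.Dual K V) (z : Module.Dual K V) :
    V →ₗ[K] Matrix (Fin p → Bool) (Fin p → Bool) K where
  toFun v := Matrix.of fun T S =>
    -- Jordan–Wigner signs: counting the occupied places before `i` makes flips at different places
    -- anticommute, and the total parity in the `z` term makes it anticommute with all flips.
    (∑ i, if S = flipAt T i then
      hyperbolicCoord x y i (T i) v * occupationSign K (Finset.univ.filter (· < i)) T else 0) +
    if S = T then z v * occupationSign K Finset.univ T else 0
  map_add' v w := by
    ext T S
    simp only [map_add, add_mul, Matrix.of_apply, Matrix.add_apply]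
    rw [add_add_add_comm, ← Finset.sum_add_distrib]
    congr 1
    · refine Finset.sum_congr rfl fun i _ => ?_
      split_ifs <;> simp
    · split_ifs <;> simp
  map_smul' c v := by
    ext T S
    simp only [map_smul, smul_eq_mul, mul_assoc, Matrix.of_apply, Matrix.smul_apply,
      RingHom.id_apply, mul_add, Finset.mul_sum, mul_ite, mul_zero]

theorem spinMap_mulVec (x y : Fin p → Module.Dual K V) (z : Module.Dual K V) (v : V)
    (ψ : (Fin p → Bool) → K) (T : Fin p → Bool) :
    (spinMap x y z v *ᵥ ψ) T =
      ∑ i, hyperbolicCoord x y i (T i) v * occupationSign K (Finset.univ.filter (· < i)) T *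
        ψ (flipAt T i) + z v * occupationSign K Finset.univ T * ψ T := by
  simp only [Matrix.mulVec, dotProduct, spinMap, LinearMap.coe_mk, AddHom.coe_mk,
    Matrix.of_apply, add_mul, Finset.sum_add_distrib, Finset.sum_mul, ite_mul, zero_mul]
  rw [Finset.sum_comm]
  simp

/-- Off-diagonal terms cancel in pairs; doubling the sum avoids choosing an order on each pair. -/
theorem sum_sum_eq_sum_diag {ι : Type*} [Fintype ι] (h2 : (2 : K) ≠ 0)
    (F : ι → ι → K) (hF : ∀ i j, i ≠ j → F i j = -F j i) :
    ∑ i, ∑ j, F i j = ∑ i, F i i := by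
  classical
  have h : ∑ i, ∑ j, (F i j + F j i) = ∑ i, 2 * F i i := by
    refine Finset.sum_congr rfl fun i _ => ?_
    rw [Finset.sum_eq_single i]
    · ring
    · intro j _ hj
      rw [hF i j hj.symm, neg_add_cancel]
    · simp
  simp only [Finset.sum_add_distrib] at h
  rw [Finset.sum_comm (f := fun i j => F j i), ← two_mul, ← Finset.mul_sum] at h
  exact mul_left_cancel₀ h2 h

theorem isCliffordMap_spinMap (h2 : (2 : K) ≠ 0) {B : LinearMap.BilinForm K V}
    {x y : Fin p → Module.Dual K V} {z : Module.Dual K V}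
    (hB : ∀ v, B v v = ∑ i, x i v * y i v + z v * z v) : IsCliffordMap B (spinMap x y z) := by
  intro v
  rw [Algebra.algebraMap_eq_smul_one]
  refine Matrix.ext_iff_mulVec.2 fun ψ => ?_
  rw [← Matrix.mulVec_mulVec, Matrix.smul_mulVec, Matrix.one_mulVec]
  funext T
  rw [spinMap_mulVec]
  simp only [spinMap_mulVec, mul_add, Finset.sum_add_distrib, Pi.smul_apply, smul_eq_mul,
    Finset.mul_sum]
  rw [sum_sum_eq_sum_diag h2]
  · have hdiag (i : Fin p) : hyperbolicCoord x y i (T i) v *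
        occupationSign K (Finset.univ.filter (· < i)) T *
          (hyperbolicCoord x y i (flipAt T i i) v *
            occupationSign K (Finset.univ.filter (· < i)) (flipAt T i) *
              ψ (flipAt (flipAt T i) i)) = x i v * y i v * ψ T := by
      rw [flipAt_flipAt, occupationSign_flipAt, if_neg (by simp), flipAt_same]
      have hs := occupationSign_mul_self (K := K) (Finset.univ.filter (· < i)) T
      cases T i <;> simp only [hyperbolicCoord, Bool.not_true, Bool.not_false, if_true,
        Bool.false_eq_true, if_false] <;> linear_combination x i v * y i v * ψ T * hs
    have hs := occupationSign_mul_self (K := K) Finset.univ T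
    rw [Finset.sum_congr rfl fun i _ => hdiag i]
    simp only [occupationSign_flipAt, Finset.mem_univ, if_true]
    rw [hB, add_mul, Finset.sum_mul, ← sub_eq_zero]
    have hcross : ∑ i, hyperbolicCoord x y i (T i) v *
        occupationSign K (Finset.univ.filter (· < i)) T *
          (z v * -occupationSign K Finset.univ T * ψ (flipAt T i)) =
        -∑ i, z v * occupationSign K Finset.univ T * (hyperbolicCoord x y i (T i) v *
          occupationSign K (Finset.univ.filter (· < i)) T * ψ (flipAt T i)) := by
      rw [← Finset.sum_neg_distrib]
      exact Finset.sum_congr rfl fun i _ => by ring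
    rw [hcross]
    linear_combination z v * z v * ψ T * hs
  · intro i j hij
    rw [flipAt_of_ne T hij, flipAt_of_ne T hij.symm, flipAt_comm T hij, occupationSign_flipAt,
      occupationSign_flipAt]
    simp only [Finset.mem_filter, Finset.mem_univ, true_and]
    rcases lt_or_gt_of_ne hij with h | h
    · rw [if_pos h, if_neg h.asymm]
      ring
    · rw [if_pos h, if_neg h.asymm]
      ring

/-- The chirality operator of the spin representation. -/
def chirality (K : Type*) [Field K] (p : ℕ) : Matrix (Fin p → Bool) (Fin p → Bool) K :=
  Matrix.diagonal (occupationSign K Finset.univ)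

/-- Every flip reverses the total parity. The `z` term is diagonal and would commute instead, hence
`z = 0`. -/
theorem chirality_mul_spinMap (x y : Fin p → Module.Dual K V) (v : V) :
    chirality K p * spinMap x y 0 v = -(spinMap x y 0 v * chirality K p) := by
  refine Matrix.ext_iff_mulVec.2 fun ψ => ?_
  rw [Matrix.neg_mulVec, ← Matrix.mulVec_mulVec, ← Matrix.mulVec_mulVec]
  funext T
  simp only [chirality, Matrix.mulVec_diagonal, Pi.neg_apply, spinMap_mulVec, LinearMap.zero_apply,
    zero_mul, add_zero, occupationSign_flipAt, Finset.mem_univ, if_true]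
  rw [Finset.mul_sum, ← Finset.sum_neg_distrib]
  exact Finset.sum_congr rfl fun i _ => by ring

variable {x y : Fin p → Module.Dual K V} {z : Module.Dual K V} {e : Fin p → V}

theorem spinMap_basis_apply (hx : ∀ i j, x i (e j) = if i = j then 1 else 0)
    (hy : ∀ i j, y i (e j) = 0) (hz : ∀ j, z (e j) = 0) (j : Fin p) (T S : Fin p → Bool) :
    spinMap x y z (e j) T S = if S = flipAt T j ∧ T j = true then
      occupationSign K (Finset.univ.filter (· < j)) T else 0 := by
  simp only [spinMap, LinearMap.coe_mk, AddHom.coe_mk, Matrix.of_apply, hz, zero_mul, ite_self,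
    add_zero]
  rw [Finset.sum_eq_single j]
  · by_cases hT : T j = true <;> simp [hyperbolicCoord, hT, hx, hy]
  · intro i _ hij
    cases hT : T i <;> simp [hyperbolicCoord, hx, hy, hij]
  · simp

theorem occupationSign_ne_zero (F : Finset (Fin p)) (T : Fin p → Bool) :
    occupationSign K F T ≠ 0 :=
  left_ne_zero_of_mul_eq_one (occupationSign_mul_self F T)

/-- The `e j` act as creation operators, so only the fully occupied state is killed by all of them:
a state `S` with `j` empty is seen in the component `flipAt S j`. -/
theorem eq_single_of_annihilated (hx : ∀ i j, x i (e j) = if i = j then 1 else 0)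
    (hy : ∀ i j, y i (e j) = 0) (hz : ∀ j, z (e j) = 0) {s : (Fin p → Bool) → K}
    (hs : ∀ j, spinMap x y z (e j) *ᵥ s = 0) :
    s = s (fun _ => true) • Pi.single (fun _ => true) 1 := by
  funext S
  by_cases hS : S = fun _ => true
  · simp [hS]
  obtain ⟨j, hj⟩ : ∃ j, S j = false := by
    by_contra! hcon
    exact hS (funext fun j => by simpa using hcon j)
  have h := congrFun (hs j) (flipAt S j)
  simp only [Matrix.mulVec, dotProduct, spinMap_basis_apply hx hy hz, flipAt_flipAt, flipAt_same,
    hj, Bool.not_false, and_true, ite_mul, zero_mul, Finset.sum_ite_eq', Finset.mem_univ, if_true,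
    Pi.zero_apply] at h
  rw [(mul_eq_zero.1 h).resolve_left (occupationSign_ne_zero _ _)]
  simp [hS]

theorem eq_single_of_coannihilated (hx : ∀ i j, x i (e j) = if i = j then 1 else 0)
    (hy : ∀ i j, y i (e j) = 0) (hz : ∀ j, z (e j) = 0) {φ : (Fin p → Bool) → K}
    (hs : ∀ j, φ ᵥ* spinMap x y z (e j) = 0) :
    φ = φ (fun _ => false) • Pi.single (fun _ => false) 1 := by
  funext T
  by_cases hT : T = fun _ => false
  · simp [hT]
  obtain ⟨j, hj⟩ : ∃ j, T j = true := by
    by_contra! hcon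
    exact hT (funext fun j => by simpa using hcon j)
  have h := congrFun (hs j) (flipAt T j)
  simp only [Matrix.vecMul, dotProduct, spinMap_basis_apply hx hy hz, eq_flipAt_iff (T := _),
    flipAt_flipAt, Pi.zero_apply] at h
  rw [Finset.sum_eq_single T] at h
  · simp only [hj, and_self, if_true] at h
    rw [(mul_eq_zero.1 h).resolve_right (occupationSign_ne_zero _ _)]
    simp [hT]
  · intro S _ hST
    rw [if_neg (by simp [hST]), mul_zero]
  · simp

theorem hasPureSpinor_span (hx : ∀ i j, x i (e j) = if i = j then 1 else 0)
    (hy : ∀ i j, y i (e j) = 0) (hz : ∀ j, z (e j) = 0) :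
    HasPureSpinor (spinMap x y z) (Submodule.span K (Set.range e)) :=
  ⟨⟨_, fun _ hs => ⟨_, eq_single_of_annihilated hx hy hz fun j =>
      hs _ (Submodule.subset_span ⟨j, rfl⟩)⟩⟩,
    ⟨_, fun _ hs => ⟨_, eq_single_of_coannihilated hx hy hz fun j =>
      hs _ (Submodule.subset_span ⟨j, rfl⟩)⟩⟩⟩

theorem hasChirality_span (hx : ∀ i j, x i (e j) = if i = j then 1 else 0)
    (hy : ∀ i j, y i (e j) = 0) (hz : ∀ j, z (e j) = 0) :
    HasChirality (spinMap x y z) (chirality K p) ((-1) ^ p)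
      (Submodule.span K (Set.range e)) := by
  intro s hs
  rw [eq_single_of_annihilated hx hy hz fun j => hs _ (Submodule.subset_span ⟨j, rfl⟩),
    Matrix.mulVec_smul, smul_comm]
  congr 1
  funext T
  rw [chirality, Matrix.mulVec_diagonal, Pi.smul_apply, smul_eq_mul]
  by_cases hT : T = fun _ => true
  · simp [hT, occupationSign]
  · simp [hT]

end SpinModule

/-! ### Minors as quadrics of rank at most four. -/

section Quadrics

variable {K M : Type*} [Field K] [AddCommGroup M] [Module K M]

/-- The quadratic form `l₁ l₂ - l₃ l₄`. -/
def minorQuadric (l₁ l₂ l₃ l₄ : Module.Dual K M) : QuadraticForm K M :=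
  QuadraticMap.linMulLin l₁ l₂ - QuadraticMap.linMulLin l₃ l₄

theorem minorQuadric_apply (l₁ l₂ l₃ l₄ : Module.Dual K M) (ω : M) :
    minorQuadric l₁ l₂ l₃ l₄ ω = l₁ ω * l₂ ω - l₃ ω * l₄ ω := rfl

/-- The polar form takes its values in the span of the four linear forms. -/
theorem quadricRank_minorQuadric_le (l₁ l₂ l₃ l₄ : Module.Dual K M) :
    quadricRank (minorQuadric l₁ l₂ l₃ l₄) ≤ 4 := by
  classical
  have hle : LinearMap.range (minorQuadric l₁ l₂ l₃ l₄).polarBilin ≤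
      Submodule.span K (({l₁, l₂, l₃, l₄} : Finset (Module.Dual K M)) : Set (Module.Dual K M)) := by
    rintro _ ⟨ω, rfl⟩
    have : (minorQuadric l₁ l₂ l₃ l₄).polarBilin ω =
        l₁ ω • l₂ + l₂ ω • l₁ - l₃ ω • l₄ - l₄ ω • l₃ := by
      ext η
      simp only [QuadraticMap.polarBilin_apply_apply, QuadraticMap.polar, minorQuadric_apply,
        map_add, LinearMap.sub_apply, LinearMap.add_apply, LinearMap.smul_apply, smul_eq_mul]
      ring
    rw [this]
    have hmem : ∀ l ∈ ({l₁, l₂, l₃, l₄} : Finset (Module.Dual K M)), ∀ a : K, a • l ∈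
        Submodule.span K (({l₁, l₂, l₃, l₄} : Finset (Module.Dual K M)) :
          Set (Module.Dual K M)) :=
      fun l hl a => Submodule.smul_mem _ _ (Submodule.subset_span hl)
    exact sub_mem (sub_mem (add_mem (hmem _ (by simp) _) (hmem _ (by simp) _))
      (hmem _ (by simp) _)) (hmem _ (by simp) _)
  have h1 := Submodule.finrank_mono hle
  have h2 := finrank_span_finset_le_card (R := K) ({l₁, l₂, l₃, l₄} : Finset (Module.Dual K M))
  exact h1.trans (h2.trans Finset.card_le_four)

/-- The quadrics given by the `2 × 2` minors of a matrix of linear forms. -/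
def minorQuadrics {I : Type*} (c : M →ₗ[K] Matrix I I K) : Set (QuadraticForm K M) :=
  {q | ∃ i j k l, q = minorQuadric (Matrix.entryLinearMap K K i j ∘ₗ c)
    (Matrix.entryLinearMap K K k l ∘ₗ c) (Matrix.entryLinearMap K K i l ∘ₗ c)
    (Matrix.entryLinearMap K K k j ∘ₗ c)}

theorem forall_minorQuadrics_iff {I : Type*} (c : M →ₗ[K] Matrix I I K) (ω : M) :
    (∀ q ∈ minorQuadrics c, q ω = 0) ↔ MinorsVanish (c ω) := by
  constructor
  · intro h i j k l
    have := h _ ⟨i, j, k, l, rfl⟩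
    rw [minorQuadric_apply] at this
    exact sub_eq_zero.1 this
  · rintro h _ ⟨i, j, k, l, rfl⟩
    rw [minorQuadric_apply]
    exact sub_eq_zero.2 (h i j k l)

theorem quadricRank_le_of_mem_minorQuadrics {I : Type*} {c : M →ₗ[K] Matrix I I K}
    {q : QuadraticForm K M} (hq : q ∈ minorQuadrics c) : quadricRank q ≤ 4 := by
  obtain ⟨i, j, k, l, rfl⟩ := hq
  exact quadricRank_minorQuadric_le _ _ _ _

theorem isClosed_linear_and_minors {I : Type*} (c : M →ₗ[K] Matrix I I K)
    (L : Set (Module.Dual K M)) : @IsClosed M (zariskiTopology K M)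
      {x | (∀ l ∈ L, l x = 0) ∧ ∀ q ∈ minorQuadrics c, q x = 0} := by
  rw [zariski_isClosed_iff]
  refine ⟨(fun l : Module.Dual K M => (l : M → K)) '' L ∪
    (fun q : QuadraticForm K M => (q : M → K)) '' minorQuadrics c, ?_, ?_⟩
  · rintro _ (⟨l, -, rfl⟩ | ⟨_, ⟨i, j, k, l, rfl⟩, rfl⟩)
    · exact linear_mem_polyFunctions l
    · exact sub_mem (mul_mem (linear_mem_polyFunctions _) (linear_mem_polyFunctions _))
        (mul_mem (linear_mem_polyFunctions _) (linear_mem_polyFunctions _))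
  · ext x
    constructor
    · rintro ⟨h1, h2⟩ _ (⟨l, hl, rfl⟩ | ⟨q, hq, rfl⟩)
      · exact h1 l hl
      · exact h2 q hq
    · exact fun h => ⟨fun l hl => h _ (Or.inl ⟨l, hl, rfl⟩), fun q hq => h _ (Or.inr ⟨q, hq, rfl⟩)⟩

end Quadrics

/-! ### The symbol in hyperbolic coordinates and the equations of the cone. -/

section HyperbolicCoordinates

variable {K V : Type*} [Field K] [AddCommGroup V] [Module K V]

/-- Coordinates in which the quadratic form is `∑ xᵢ yᵢ + z²`, together with an isotropic family
dual to the `xᵢ`. -/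
structure HyperbolicCoordinates (B : LinearMap.BilinForm K V) (p : ℕ) where
  x : Fin p → Module.Dual K V
  y : Fin p → Module.Dual K V
  z : Module.Dual K V
  e : Fin p → V
  quad : ∀ v, B v v = ∑ i, x i v * y i v + z v * z v
  x_e : ∀ i j, x i (e j) = if i = j then 1 else 0
  y_e : ∀ i j, y i (e j) = 0
  z_e : ∀ j, z (e j) = 0
  e_e : ∀ i j, B (e i) (e j) = 0

namespace HyperbolicCoordinates

variable {B : LinearMap.BilinForm K V} {p : ℕ} (H : HyperbolicCoordinates B p)
  (h2 : (2 : K) ≠ 0)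

/-- The spin representation given by hyperbolic coordinates. -/
def spin : V →ₗ[K] Matrix (Fin p → Bool) (Fin p → Bool) K := spinMap H.x H.y H.z

theorem isCliffordMap (h2 : (2 : K) ≠ 0) : IsCliffordMap B H.spin := isCliffordMap_spinMap h2 H.quad

/-- The matrix of linear forms on `⋀ᵖ V` whose minors cut out the isotropic cone. -/
noncomputable def symbol : ⋀[K]^p V →ₗ[K] Matrix (Fin p → Bool) (Fin p → Bool) K :=
  (H.isCliffordMap h2).quantize p

theorem linearIndependent_e : LinearIndependent K H.e := by
  rw [Fintype.linearIndependent_iff]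
  intro g hg i
  have := congrArg (H.x i) hg
  simpa [H.x_e] using this

theorem isTotallyIsotropic_span_e :
    IsTotallyIsotropic B (Submodule.span K (Set.range H.e)) :=
  isTotallyIsotropic_span (by rintro _ ⟨i, rfl⟩ _ ⟨j, rfl⟩; exact H.e_e i j)

theorem finrank_span_e : Module.finrank K (Submodule.span K (Set.range H.e)) = p := by
  rw [finrank_span_eq_card H.linearIndependent_e, Fintype.card_fin]

/-- The linear forms whose vanishing says that the symbol has chirality `ε`. -/
noncomputable def chiralForms (ε : K) : Set (Module.Dual K (⋀[K]^p V)) :=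
  {f | ∃ T S, f = (occupationSign K Finset.univ T - ε) •
    (Matrix.entryLinearMap K K T S ∘ₗ H.symbol h2)}

/-- Chirality is diagonal, so the eigenvector equation is a linear condition on each entry. -/
theorem forall_chiralForms_iff (ε : K) (ω : ⋀[K]^p V) :
    (∀ f ∈ H.chiralForms h2 ε, f ω = 0) ↔
      chirality K p * H.symbol h2 ω = ε • H.symbol h2 ω := by
  constructor
  · intro h
    ext T S
    have := h _ ⟨T, S, rfl⟩
    rw [chirality, Matrix.diagonal_mul, Matrix.smul_apply, smul_eq_mul, ← sub_eq_zero, ← sub_mul]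
    exact this
  · rintro h _ ⟨T, S, rfl⟩
    have := congrFun (congrFun h T) S
    rw [chirality, Matrix.diagonal_mul, Matrix.smul_apply, smul_eq_mul, ← sub_eq_zero,
      ← sub_mul] at this
    exact this

variable [FiniteDimensional K V]

theorem finrank_le_of_isTotallyIsotropic
    (hB' : B.Nondegenerate) (hdim : Module.finrank K V = 2 * p ∨ Module.finrank K V = 2 * p + 1)
    (N : Submodule K V) (hN : IsTotallyIsotropic B N) :
    Module.finrank K N ≤ p := by
  have := hN.two_mul_finrank_le hB'
  omega

/-- The span of the `e i` is treated explicitly, and reflections carry it to every other `N`. -/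
theorem hasPureSpinor (h2 : (2 : K) ≠ 0) (hB : B.IsSymm) (hB' : B.Nondegenerate)
    (hdim : Module.finrank K V = 2 * p ∨ Module.finrank K V = 2 * p + 1)
    (N : Submodule K V) (hN : IsTotallyIsotropic B N)
    (hNp : Module.finrank K N = p) : HasPureSpinor H.spin N := by
  obtain ⟨l, hl, rfl⟩ := exists_map_scaledReflections_eq h2 hB
    (finrank_le_of_isTotallyIsotropic hB' hdim) H.isTotallyIsotropic_span_e hN
    H.finrank_span_e hNp
  exact (hasPureSpinor_span H.x_e H.y_e H.z_e).map_scaledReflections (H.isCliffordMap h2) hB l hl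

theorem exists_orthogonal_basis (h2 : (2 : K) ≠ 0) (hB : B.IsSymm) :
    ∃ u : Module.Basis (Fin (Module.finrank K V)) K V, ∀ i j, i ≠ j → B (u i) (u j) = 0 := by
  let := invertibleOfNonzero h2
  obtain ⟨u, hu⟩ := LinearMap.BilinForm.exists_orthogonal_basis
    (LinearMap.BilinForm.isSymm_iff.1 hB)
  exact ⟨u, fun i j hij => hu hij⟩

theorem symbol_injective
    (hB : B.IsSymm) (hB' : B.Nondegenerate) : Function.Injective (H.symbol h2) := by
  obtain ⟨u, hu⟩ := exists_orthogonal_basis h2 hB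
  exact (H.isCliffordMap h2).quantize_injective p h2 hB u hu
    (LinearMap.BilinForm.iIsOrtho.not_isOrtho_basis_self_of_nondegenerate
      (fun i j hij => hu i j hij) hB')

theorem mem_cone_iff (hB : B.IsSymm) (hB' : B.Nondegenerate)
    (hdim : Module.finrank K V = 2 * p ∨ Module.finrank K V = 2 * p + 1)
    (hp : 1 ≤ p) (ω : ⋀[K]^p V) :
    ω ∈ isoGrassmannCone B p ↔ MinorsVanish (H.symbol h2 ω) := by
  obtain ⟨u, hu⟩ := exists_orthogonal_basis h2 hB
  exact ⟨(H.isCliffordMap h2).minorsVanish_of_mem_cone hB (H.hasPureSpinor h2 hB hB' hdim),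
    (H.isCliffordMap h2).mem_cone_of_minorsVanish h2 hB hB' u hu hp hdim
      (H.hasPureSpinor h2 hB hB' hdim)⟩

theorem definedByQuadrics
    (H : HyperbolicCoordinates B p) (h2 : (2 : K) ≠ 0) (hB : B.IsSymm) (hB' : B.Nondegenerate)
    (hdim : Module.finrank K V = 2 * p ∨ Module.finrank K V = 2 * p + 1)
    (hp : 1 ≤ p) : DefinedByQuadrics K 4 (isoGrassmannCone B p) := by
  refine ⟨minorQuadrics (H.symbol h2), fun q => quadricRank_le_of_mem_minorQuadrics, ?_⟩
  ext ω
  rw [H.mem_cone_iff h2 hB hB' hdim hp]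
  exact (forall_minorQuadrics_iff _ ω).symm

/-- The part of the isotropic cone of chirality `ε`. -/
def chiralCone (ε : K) : Set (⋀[K]^p V) :=
  {ω | (∀ f ∈ H.chiralForms h2 ε, f ω = 0) ∧ ∀ q ∈ minorQuadrics (H.symbol h2), q ω = 0}

theorem mem_chiralCone_iff (hB : B.IsSymm) (hB' : B.Nondegenerate)
    (hdim : Module.finrank K V = 2 * p ∨ Module.finrank K V = 2 * p + 1)
    (hp : 1 ≤ p) (ε : K) (ω : ⋀[K]^p V) : ω ∈ H.chiralCone h2 ε ↔
    chirality K p * H.symbol h2 ω = ε • H.symbol h2 ω ∧ ω ∈ isoGrassmannCone B p := by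
  rw [H.mem_cone_iff h2 hB hB' hdim hp, ← forall_chiralForms_iff, ← forall_minorQuadrics_iff]
  rfl

end HyperbolicCoordinates

end HyperbolicCoordinates

/-! ### Joining points of the cone by polynomial curves. -/

section SameSpan

variable {K V : Type*} [Field K] [AddCommGroup V] [Module K V]

/-- Families with the same span have proportional wedge products. -/
theorem exists_ιMulti_eq_smul {k : ℕ} {n m : Fin k → V} (hm : LinearIndependent K m)
    (hn : ∀ i, n i ∈ Submodule.span K (Set.range m)) :
    ∃ c : K, exteriorPower.ιMulti K k n = c • exteriorPower.ιMulti K k m := by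
  set M := Submodule.span K (Set.range m) with hM
  let b := Module.Basis.span hm
  -- The top exterior power of the common span is a line.
  have hfin : Module.finrank K (⋀[K]^k M) = 1 := by
    have := Module.Finite.of_basis b
    rw [exteriorPower.finrank_eq, Module.finrank_eq_card_basis b, Fintype.card_fin,
      Nat.choose_self]
  have hb0 : exteriorPower.ιMulti K k b ≠ 0 :=
    ιMulti_ne_zero_of_linearIndependent b.linearIndependent
  obtain ⟨c, hc⟩ := (finrank_eq_one_iff_of_nonzero' _ hb0).1 hfin
    (exteriorPower.ιMulti K k fun i => (⟨n i, hn i⟩ : M))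
  refine ⟨c, ?_⟩
  have h := congrArg (exteriorPower.map k M.subtype) hc
  rw [map_smul, exteriorPower.map_apply_ιMulti, exteriorPower.map_apply_ιMulti] at h
  have hbm : M.subtype ∘ b = m := funext fun i => by
    simp [b, Module.Basis.span_apply]
  rw [hbm] at h
  exact h.symm

/-- Two nonzero points of the cone linked by an even number of reflections lie on a polynomial
curve contained in the cone. -/
theorem exists_polynomialCurve_of_even_reflections [FiniteDimensional K V]
    {B : LinearMap.BilinForm K V} (hB : B.IsSymm) {p : ℕ} {n m : Fin p → V} (hp : 1 ≤ p)
    (hn : ∀ i j, B (n i) (n j) = 0)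
    (hn0 : exteriorPower.ιMulti K p n ≠ 0) (hm0 : exteriorPower.ιMulti K p m ≠ 0)
    {l : List V} (hl : ∀ u ∈ l, B u u ≠ 0) (heven : Even l.length)
    (hlm : (Submodule.span K (Set.range n)).map (scaledReflections B l) =
      Submodule.span K (Set.range m)) :
    ∃ κ : K → ⋀[K]^p V, IsPolynomialCurve κ ∧ (∀ t, κ t ∈ isoGrassmannCone B p) ∧
      κ 0 = exteriorPower.ιMulti K p n ∧ κ 1 = exteriorPower.ιMulti K p m := by
  obtain ⟨l', c, hlen, hc, hl'⟩ := exists_scaledReflections_eq_smul B l heven hl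
  have hli {v : Fin p → V} (hv : exteriorPower.ιMulti K p v ≠ 0) : LinearIndependent K v := by
    by_contra h
    exact hv ((exteriorPower.ιMulti K p).map_linearDependent v h)
  obtain ⟨d, hd⟩ := exists_ιMulti_eq_smul (k := p) (n := fun i => scaledReflections B l (n i))
    (hli hm0) fun i => by
      rw [← hlm]
      exact Submodule.mem_map_of_mem (Submodule.subset_span ⟨i, rfl⟩)
  have hd0 : d ≠ 0 := by
    rintro rfl
    rw [zero_smul] at hd
    refine ιMulti_ne_zero_of_linearIndependent ?_ hd
    exact (hli hn0).map' _ (LinearMap.ker_eq_bot.2 (scaledReflections_injective l hl))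
  -- Straight lines from the cancelling list `l'` to `l`. A vector may become isotropic on the way,
  -- but scaled reflections still carry isotropic families to isotropic families.
  let path : List (K → V) := (l'.zip l).map fun ab t => (1 - t) • ab.1 + t • ab.2
  have hpath : ∀ u ∈ path, IsPolynomialCurve u := by
    intro u hu
    obtain ⟨ab, -, rfl⟩ := List.mem_map.1 hu
    exact isPolynomialCurve_lineMap ab.1 ab.2
  have hpath0 : path.map (fun u => u 0) = l' := by
    simp only [path, List.map_map, Function.comp_def, sub_zero, one_smul, zero_smul, add_zero]
    exact List.map_fst_zip hlen.le
  have hpath1 : path.map (fun u => u 1) = l := by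
    simp only [path, List.map_map, Function.comp_def, sub_self, one_smul, zero_smul, zero_add]
    exact List.map_snd_zip hlen.ge
  -- The scalar factor normalizes the endpoints: it is `c⁻ᵖ` at `t = 0` and `d⁻¹` at `t = 1`. Its
  -- zeros are harmless, since the cone contains 0.
  refine ⟨fun t => ((1 - t) • (c ^ p)⁻¹ + t • d⁻¹) • exteriorPower.ιMulti K p fun i =>
    scaledReflections B (path.map fun u => u t) (n i), ?_, ?_, ?_, ?_⟩
  · exact IsPolynomialCurve.smul (isPolynomialCurve_lineMap (M := K) _ _ LinearMap.id)
      (IsPolynomialCurve.ιMulti fun i =>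
        IsPolynomialCurve.scaledReflections B path hpath (isPolynomialCurve_const (n i)))
  · exact fun t => smul_mem_isoGrassmannCone hp _
      ⟨_, fun i j => bilin_scaledReflections_eq_zero hB _ (hn i j), rfl⟩
  · have : (exteriorPower.ιMulti K p fun i => c • n i) = c ^ p • exteriorPower.ιMulti K p n := by
      have := (exteriorPower.ιMulti K p (M := V)).toMultilinearMap.map_smul_univ (fun _ => c) n
      rwa [Finset.prod_const, Finset.card_univ, Fintype.card_fin] at this
    simp only [hpath0, hl', LinearMap.smul_apply, LinearMap.id_apply, this, sub_zero, one_smul,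
      zero_smul, add_zero]
    rw [smul_smul, inv_mul_cancel₀ (pow_ne_zero p hc), one_smul]
  · simp only [hpath1, hd, sub_self, one_smul, zero_smul, zero_add]
    rw [smul_smul, inv_mul_cancel₀ hd0, one_smul]

end SameSpan

/-! ### The two components in even dimension. -/

namespace HyperbolicCoordinates

variable {K V : Type*} [Field K] [AddCommGroup V] [Module K V]
  {B : LinearMap.BilinForm K V} {p : ℕ} (H : HyperbolicCoordinates B p) (h2 : (2 : K) ≠ 0)

theorem chirality_mul_spin (hz : H.z = 0)
    (v : V) :
    chirality K p * H.spin v = -(H.spin v * chirality K p) := by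
  rw [spin, hz]
  exact chirality_mul_spinMap H.x H.y v

theorem chirality_mul_symbol (hB : B.IsSymm)
    {n : Fin p → V} (hn : ∀ i j, B (n i) (n j) = 0) {ε : K}
    (h : HasChirality H.spin (chirality K p) ε (Submodule.span K (Set.range n))) :
    chirality K p * H.symbol h2 (exteriorPower.ιMulti K p n) =
      ε • H.symbol h2 (exteriorPower.ιMulti K p n) :=
  (H.isCliffordMap h2).mul_quantize_of_chirality hB hn h

variable [FiniteDimensional K V]

theorem exists_hasChirality
    (h2 : (2 : K) ≠ 0) (hB : B.IsSymm) (hz : H.z = 0) (hB' : B.Nondegenerate)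
    (hdim : Module.finrank K V = 2 * p)
    (N : Submodule K V) (hN : IsTotallyIsotropic B N)
    (hNp : Module.finrank K N = p) : ∃ ε : K, (ε = 1 ∨ ε = -1) ∧
      HasChirality H.spin (chirality K p) ε N := by
  obtain ⟨l, hl, rfl⟩ := exists_map_scaledReflections_eq h2 hB
    (finrank_le_of_isTotallyIsotropic hB' (Or.inl hdim)) H.isTotallyIsotropic_span_e hN
    H.finrank_span_e hNp
  refine ⟨_, ?_, (hasChirality_span H.x_e H.y_e H.z_e).map_scaledReflections (H.isCliffordMap h2)
    hB (H.chirality_mul_spin hz) l hl⟩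
  rw [← pow_add]
  exact neg_one_pow_eq_or K _

theorem cone_eq_union
    (hB : B.IsSymm) (hz : H.z = 0) (hB' : B.Nondegenerate) (hdim : Module.finrank K V = 2 * p)
    (hp : 1 ≤ p) :
    isoGrassmannCone B p = H.chiralCone h2 1 ∪ H.chiralCone h2 (-1) := by
  have hd := Or.inl (b := Module.finrank K V = 2 * p + 1) hdim
  ext ω
  rw [Set.mem_union, H.mem_chiralCone_iff h2 hB hB' hd hp,
    H.mem_chiralCone_iff h2 hB hB' hd hp, ← or_and_right]
  refine ⟨fun h => ⟨?_, h⟩, fun h => h.2⟩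
  obtain ⟨n, hn, rfl⟩ := h
  by_cases h0 : exteriorPower.ιMulti K p n = 0
  · left
    rw [h0, map_zero, mul_zero, smul_zero]
  obtain ⟨ε, hε, hc⟩ := H.exists_hasChirality h2 hB hz hB' hdim _ (isTotallyIsotropic_span (by
    rintro _ ⟨i, rfl⟩ _ ⟨j, rfl⟩
    exact hn i j)) (finrank_span_range_of_ιMulti_ne_zero h0)
  have := H.chirality_mul_symbol h2 hB hn hc
  rcases hε with rfl | rfl
  · exact Or.inl this
  · exact Or.inr this

theorem eq_of_chirality (hB : B.IsSymm) (hB' : B.Nondegenerate)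
    {ω : ⋀[K]^p V} (hω : ω ≠ 0) {ε ε' : K}
    (h : chirality K p * H.symbol h2 ω = ε • H.symbol h2 ω)
    (h' : chirality K p * H.symbol h2 ω = ε' • H.symbol h2 ω) : ε = ε' := by
  have h0 : H.symbol h2 ω ≠ 0 := fun h0 =>
    hω (H.symbol_injective h2 hB hB' (h0.trans (map_zero _).symm))
  exact smul_left_injective K h0 (h.symm.trans h')

theorem zero_mem_chiralCone
    (hB : B.IsSymm) (hB' : B.Nondegenerate) (hdim : Module.finrank K V = 2 * p) (hp : 1 ≤ p)
    (ε : K) : 0 ∈ H.chiralCone h2 ε := by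
  rw [H.mem_chiralCone_iff h2 hB hB' (Or.inl hdim) hp]
  exact ⟨by simp, zero_mem_isoGrassmannCone hp⟩

theorem isIrreducible_chiralCone
    (hB : B.IsSymm) (hz : H.z = 0) (hB' : B.Nondegenerate) (hdim : Module.finrank K V = 2 * p)
    (hp : 1 ≤ p)
    [Infinite K] {ε : K} (hε : ε = 1 ∨ ε = -1) :
    @IsIrreducible _ (zariskiTopology K (⋀[K]^p V)) (H.chiralCone h2 ε) := by
  let _ := zariskiTopology K (⋀[K]^p V)
  have hd := Or.inl (b := Module.finrank K V = 2 * p + 1) hdim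
  have hmem (ε : K) (ω) := H.mem_chiralCone_iff h2 hB hB' hd hp ε ω
  have hzero := H.zero_mem_chiralCone h2 hB hB' hdim hp ε
  have hε0 : ε ≠ 0 := by rcases hε with rfl | rfl <;> simp
  -- If one of the two points is 0, the line through the origin and the other point joins them.
  have hline (ω) (hω : ω ∈ H.chiralCone h2 ε) : ∃ T ⊆ H.chiralCone h2 ε,
      IsIrreducible T ∧ 0 ∈ T ∧ ω ∈ T := by
    refine ⟨Set.range fun t : K => t • ω, ?_, IsPolynomialCurve.isIrreducible_range (K := K)
      (IsPolynomialCurve.smul id_mem_linePolynomials (isPolynomialCurve_const ω)), ⟨0, by simp⟩,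
      ⟨1, by simp⟩⟩
    rintro _ ⟨t, rfl⟩
    rw [hmem] at hω ⊢
    refine ⟨?_, smul_mem_isoGrassmannCone hp t hω.2⟩
    simp only [map_smul, Matrix.mul_smul]
    rw [hω.1, smul_comm]
  refine isIrreducible_of_pairs ⟨0, hzero⟩ fun ω hω η hη => ?_
  by_cases hω0 : ω = 0
  · obtain ⟨T, hT, hTi, h0, h1⟩ := hline η hη
    exact ⟨T, hT, hTi, hω0 ▸ h0, h1⟩
  by_cases hη0 : η = 0
  · obtain ⟨T, hT, hTi, h0, h1⟩ := hline ω hω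
    exact ⟨T, hT, hTi, h1, hη0 ▸ h0⟩
  obtain ⟨hωc, n, hn, rfl⟩ := (hmem _ _).1 hω
  obtain ⟨hηc, m, hm, rfl⟩ := (hmem _ _).1 hη
  have hiso {v : Fin p → V} (hv : ∀ i j, B (v i) (v j) = 0) :
      IsTotallyIsotropic B (Submodule.span K (Set.range v)) := isTotallyIsotropic_span (by
    rintro _ ⟨i, rfl⟩ _ ⟨j, rfl⟩
    exact hv i j)
  have hNd := finrank_span_range_of_ιMulti_ne_zero hω0
  obtain ⟨l, hl, hlm⟩ := exists_map_scaledReflections_eq h2 hB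
    (finrank_le_of_isTotallyIsotropic hB' hd) (hiso hn) (hiso hm) hNd
    (finrank_span_range_of_ιMulti_ne_zero hη0)
  obtain ⟨ε', -, hε'⟩ := H.exists_hasChirality h2 hB hz hB' hdim _ (hiso hn) hNd
  have he1 := H.eq_of_chirality h2 hB hB' hω0 (H.chirality_mul_symbol h2 hB hn hε') hωc
  subst he1
  have hM := hε'.map_scaledReflections (H.isCliffordMap h2) hB (H.chirality_mul_spin hz) l hl
  rw [hlm] at hM
  have he2 := H.eq_of_chirality h2 hB hB' hη0 (H.chirality_mul_symbol h2 hB hm hM) hηc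
  -- An odd number of reflections would reverse the chirality, whereas both points have chirality
  -- `ε'`.
  have heven : Even l.length := by
    by_contra hodd
    rw [Nat.not_even_iff_odd] at hodd
    rw [hodd.neg_one_pow, neg_one_mul, neg_eq_iff_add_eq_zero, ← two_mul] at he2
    exact hε0 ((mul_eq_zero.1 he2).resolve_left h2)
  obtain ⟨κ, hκ, hκc, hκ0, hκ1⟩ := exists_polynomialCurve_of_even_reflections hB hp hn hω0 hη0
    hl heven hlm
  refine ⟨Set.range κ, ?_, hκ.isIrreducible_range, ⟨0, hκ0⟩, ⟨1, hκ1⟩⟩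
  -- The curve is irreducible and covered by two closed chiral cones, so it lies in one of them; its
  -- point at 0 decides which.
  have hcover : Set.range κ ⊆ H.chiralCone h2 ε' ∪ H.chiralCone h2 (-ε') := by
    have hc := H.cone_eq_union h2 hB hz hB' hdim hp
    rintro _ ⟨t, rfl⟩
    have := hκc t
    rw [hc] at this
    rcases hε with rfl | rfl
    · exact this
    · rw [neg_neg]
      exact this.symm
  rcases (isIrreducible_iff_closed_cover.1 (hκ.isIrreducible_range)).2 _ _
    (isClosed_linear_and_minors _ _) (isClosed_linear_and_minors _ _) hcover with h | h
  · exact h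
  · have h1 := ((hmem _ _).1 (h ⟨0, hκ0⟩)).1
    have := H.eq_of_chirality h2 hB hB' hω0 hωc h1
    rw [eq_neg_iff_add_eq_zero, ← two_mul] at this
    exact absurd ((mul_eq_zero.1 this).resolve_left h2) hε0

theorem exists_mem_chiralCone_ne_zero
    (hB : B.IsSymm) (hz : H.z = 0) (hB' : B.Nondegenerate) (hdim : Module.finrank K V = 2 * p)
    (hp : 1 ≤ p)
    {ε : K} (hε : ε = 1 ∨ ε = -1) :
    ∃ ω ∈ H.chiralCone h2 ε, ω ≠ 0 := by
  have hd := Or.inl (b := Module.finrank K V = 2 * p + 1) hdim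
  have hE := hasChirality_span (K := K) H.x_e H.y_e H.z_e
  have hcases : ε = (-1) ^ p ∨ ε = -(-1) ^ p := by
    rcases neg_one_pow_eq_or K p with h | h <;> rcases hε with rfl | rfl <;> simp [h]
  rcases hcases with rfl | rfl
  · refine ⟨exteriorPower.ιMulti K p H.e, ?_,
      ιMulti_ne_zero_of_linearIndependent H.linearIndependent_e⟩
    rw [H.mem_chiralCone_iff h2 hB hB' hd hp]
    exact ⟨H.chirality_mul_symbol h2 hB H.e_e hE, H.e, H.e_e, rfl⟩
  -- One reflection of the family `e` gives the opposite chirality; an anisotropic vector exists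
  -- because `dim V = 2p > 0`.
  · obtain ⟨u, hu⟩ := exists_orthogonal_basis h2 hB
    have hu0 := LinearMap.BilinForm.iIsOrtho.not_isOrtho_basis_self_of_nondegenerate
      (fun i j hij => hu i j hij) hB' ⟨0, by omega⟩
    set w := u ⟨0, by omega⟩
    have hiso : ∀ i j, B (scaledReflection B w (H.e i)) (scaledReflection B w (H.e j)) = 0 :=
      fun i j => by rw [bilin_scaledReflection hB, H.e_e, mul_zero]
    refine ⟨exteriorPower.ιMulti K p fun i => scaledReflection B w (H.e i), ?_,
      ιMulti_ne_zero_of_linearIndependent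
        (H.linearIndependent_e.map' _ (LinearMap.ker_eq_bot.2 (scaledReflection_injective hu0)))⟩
    rw [H.mem_chiralCone_iff h2 hB hB' hd hp]
    refine ⟨H.chirality_mul_symbol h2 hB hiso ?_, _, hiso, rfl⟩
    have := hE.map_scaledReflection (H.isCliffordMap h2) hB (H.chirality_mul_spin hz) hu0
    rwa [Submodule.map_span, ← Set.range_comp] at this

theorem not_chiralCone_subset
    (hB : B.IsSymm) (hz : H.z = 0) (hB' : B.Nondegenerate) (hdim : Module.finrank K V = 2 * p)
    (hp : 1 ≤ p)
    {ε : K} (hε : ε = 1 ∨ ε = -1) :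
    ¬H.chiralCone h2 ε ⊆ H.chiralCone h2 (-ε) := by
  have hd := Or.inl (b := Module.finrank K V = 2 * p + 1) hdim
  intro h
  obtain ⟨ω, hω, hω0⟩ := H.exists_mem_chiralCone_ne_zero h2 hB hz hB' hdim hp hε
  have h1 := ((H.mem_chiralCone_iff h2 hB hB' hd hp _ _).1 hω).1
  have h2' := ((H.mem_chiralCone_iff h2 hB hB' hd hp _ _).1 (h hω)).1
  have := H.eq_of_chirality h2 hB hB' hω0 h1 h2'
  rw [eq_neg_iff_add_eq_zero, ← two_mul] at this
  have hε0 : ε ≠ 0 := by rcases hε with rfl | rfl <;> simp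
  exact hε0 ((mul_eq_zero.1 this).resolve_left h2)

theorem zariskiComponents_cone
    (hB : B.IsSymm) (hz : H.z = 0) (hB' : B.Nondegenerate) (hdim : Module.finrank K V = 2 * p)
    (hp : 1 ≤ p)
    [Infinite K] :
    zariskiComponents K (isoGrassmannCone B p) = {H.chiralCone h2 1, H.chiralCone h2 (-1)} := by
  rw [H.cone_eq_union h2 hB hz hB' hdim hp]
  refine zariskiComponents_union (isClosed_linear_and_minors _ _) (isClosed_linear_and_minors _ _)
    (H.isIrreducible_chiralCone h2 hB hz hB' hdim hp (Or.inl rfl))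
    (H.isIrreducible_chiralCone h2 hB hz hB' hdim hp (Or.inr rfl))
    (H.not_chiralCone_subset h2 hB hz hB' hdim hp (Or.inl rfl)) ?_
  have := H.not_chiralCone_subset h2 hB hz hB' hdim hp (Or.inr rfl)
  rwa [neg_neg] at this

theorem ncard_zariskiComponents_cone
    (H : HyperbolicCoordinates B p) (h2 : (2 : K) ≠ 0) (hB : B.IsSymm) (hz : H.z = 0)
    (hB' : B.Nondegenerate) (hdim : Module.finrank K V = 2 * p) (hp : 1 ≤ p)
    [Infinite K] :
    (zariskiComponents K (isoGrassmannCone B p)).ncard = 2 := by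
  rw [H.zariskiComponents_cone h2 hB hz hB' hdim hp, Set.ncard_pair]
  intro h
  exact H.not_chiralCone_subset h2 hB hz hB' hdim hp (Or.inl rfl) h.subset

end HyperbolicCoordinates

/-! ### Hyperbolic coordinates from a maximal isotropic subspace. -/

section WittDecomposition

variable {K V : Type*} [Field K] [AddCommGroup V] [Module K V]

/-- A totally isotropic subspace of dimension `p` is half of a sum of `p` hyperbolic planes. -/
theorem exists_hyperbolic_family [FiniteDimensional K V]
    {B : LinearMap.BilinForm K V} (h2 : (2 : K) ≠ 0) (hB : B.IsSymm)
    (hB' : B.Nondegenerate) {p : ℕ} {L : Submodule K V} (hL : Module.finrank K L = p)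
    (hiso : ∀ u ∈ L, ∀ v ∈ L, B u v = 0) :
    ∃ e f : Fin p → V, (∀ i j, B (e i) (e j) = 0) ∧ (∀ i j, B (f i) (f j) = 0) ∧
      ∀ i j, B (e i) (f j) = if i = j then 1 else 0 := by
  set e : Fin p → V := fun i => (Module.finBasisOfFinrankEq K L hL i : V)
  have he : ∀ i j, B (e i) (e j) = 0 := fun i j => hiso _ (Subtype.coe_prop _) _
    (Subtype.coe_prop _)
  have heli : LinearIndependent K e :=
    (Module.finBasisOfFinrankEq K L hL).linearIndependent.map' L.subtype L.ker_subtype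
  obtain ⟨d, hd⟩ := LinearMap.exists_leftInverse_of_injective _
    (LinearMap.ker_eq_bot'.2 (linearIndependent_iff.1 heli))
  let g : Fin p → V := fun j => (B.toDual hB').symm (Finsupp.lapply j ∘ₗ d)
  have hg : ∀ i j, B (g j) (e i) = if i = j then 1 else 0 := by
    intro i j
    have := LinearMap.congr_fun hd (Finsupp.single i 1)
    simp only [LinearMap.comp_apply, Finsupp.linearCombination_single, one_smul,
      LinearMap.id_apply] at this
    simp only [g, LinearMap.BilinForm.apply_toDual_symm_apply, LinearMap.comp_apply, this,
      Finsupp.lapply_apply, Finsupp.single_apply]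
  have hg' : ∀ i j, B (e i) (g j) = if i = j then 1 else 0 := fun i j =>
    (hB.eq (e i) (g j)).trans (hg i j)
  -- The `g j` are dual to `e` but need not be isotropic; subtracting half of their Gram matrix in
  -- the `e k` corrects this without changing the pairing with `e`.
  refine ⟨e, fun j => g j - ∑ k, (2⁻¹ * B (g j) (g k)) • e k, he, fun i j => ?_, fun i j => ?_⟩
  · simp only [map_sub, map_sum, map_smul, LinearMap.sub_apply, LinearMap.sum_apply,
      LinearMap.smul_apply, smul_eq_mul, hg, hg', he, mul_zero, Finset.sum_const_zero, sub_zero,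
      mul_ite, mul_one, Finset.sum_ite_eq', Finset.mem_univ, if_true]
    rw [show B (g j) (g i) = B (g i) (g j) from hB.eq _ _]
    field_simp
    ring
  · simp only [map_sub, map_sum, map_smul, smul_eq_mul, he, hg', mul_zero,
      Finset.sum_const_zero, sub_zero]

variable {B : LinearMap.BilinForm K V} {p : ℕ} {e f : Fin p → V}

/-- The component of a vector orthogonal to a sum of hyperbolic planes. -/
def hyperbolicResidue (B : LinearMap.BilinForm K V) (e f : Fin p → V) (v : V) : V :=
  v - ∑ i, (B v (f i) • e i + B v (e i) • f i)

theorem bilin_hyperbolicResidue_left (hB : B.IsSymm) (he : ∀ i j, B (e i) (e j) = 0)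
    (hef : ∀ i j, B (e i) (f j) = if i = j then 1 else 0) (v : V) (j : Fin p) :
    B (e j) (hyperbolicResidue B e f v) = 0 := by
  simp only [hyperbolicResidue, map_sub, map_sum, map_add, map_smul, smul_eq_mul, he, hef,
    mul_zero, zero_add, mul_ite, mul_one, Finset.sum_ite_eq, Finset.mem_univ, if_true]
  rw [show B (e j) v = B v (e j) from hB.eq _ _, sub_self]

theorem bilin_hyperbolicResidue_right (hB : B.IsSymm) (hf : ∀ i j, B (f i) (f j) = 0)
    (hef : ∀ i j, B (e i) (f j) = if i = j then 1 else 0) (v : V) (j : Fin p) :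
    B (f j) (hyperbolicResidue B e f v) = 0 := by
  have hfe : ∀ i, B (f j) (e i) = if i = j then 1 else 0 := fun i => (hB.eq _ _).trans (hef i j)
  simp only [hyperbolicResidue, map_sub, map_sum, map_add, map_smul, smul_eq_mul, hf, hfe,
    mul_zero, add_zero, mul_ite, mul_one, Finset.sum_ite_eq', Finset.mem_univ, if_true]
  rw [show B (f j) v = B v (f j) from hB.eq _ _, sub_self]

theorem bilin_self_eq_hyperbolic (hB : B.IsSymm) (he : ∀ i j, B (e i) (e j) = 0)
    (hf : ∀ i j, B (f i) (f j) = 0) (hef : ∀ i j, B (e i) (f j) = if i = j then 1 else 0)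
    (v : V) :
    B v v = ∑ i, B v (f i) * (2 * B v (e i)) +
      B (hyperbolicResidue B e f v) (hyperbolicResidue B e f v) := by
  set r := hyperbolicResidue B e f v with hr
  have hv : v = r + ∑ i, (B v (f i) • e i + B v (e i) • f i) := by rw [hr, hyperbolicResidue]; abel
  have h1 : B v r = B r r := by
    conv_lhs => rw [hv]
    simp only [map_add, map_sum, map_smul, LinearMap.add_apply, LinearMap.sum_apply,
      LinearMap.smul_apply, bilin_hyperbolicResidue_left hB he hef v,
      bilin_hyperbolicResidue_right hB hf hef v, smul_zero, add_zero, Finset.sum_const_zero, hr]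
  have h2 : B v v = B v r + ∑ i, (B v (f i) * B v (e i) + B v (e i) * B v (f i)) := by
    conv_lhs => rw [show B v v = B v (r + ∑ i, (B v (f i) • e i + B v (e i) • f i)) by rw [← hv]]
    simp only [map_add, map_sum, map_smul, smul_eq_mul]
  rw [h2, h1, add_comm]
  congr 1
  exact Finset.sum_congr rfl fun i _ => by ring

/-- The span of a hyperbolic family. -/
def hyperbolicSpan (K : Type*) {V : Type*} [Field K] [AddCommGroup V] [Module K V]
    {p : ℕ} (e f : Fin p → V) : Submodule K V :=
  Submodule.span K (Set.range (Sum.elim e f))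

theorem finrank_hyperbolicSpan (hB : B.IsSymm) (he : ∀ i j, B (e i) (e j) = 0)
    (hf : ∀ i j, B (f i) (f j) = 0) (hef : ∀ i j, B (e i) (f j) = if i = j then 1 else 0) :
    Module.finrank K (hyperbolicSpan K e f) = 2 * p := by
  have : LinearIndependent K (Sum.elim e f) := by
    rw [Fintype.linearIndependent_iff]
    intro g hg
    have hfe : ∀ i j, B (f i) (e j) = if j = i then 1 else 0 := fun i j =>
      (hB.eq _ _).trans (hef j i)
    rw [Fintype.sum_sum_type] at hg
    rintro (i | i)
    · have := congrArg (B (f i)) hg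
      simpa [hf, hfe] using this
    · have := congrArg (B (e i)) hg
      simpa [he, hef] using this
  rw [hyperbolicSpan, finrank_span_eq_card this]
  simp [two_mul]

theorem hyperbolicResidue_mem_orthogonal (hB : B.IsSymm) (he : ∀ i j, B (e i) (e j) = 0)
    (hf : ∀ i j, B (f i) (f j) = 0) (hef : ∀ i j, B (e i) (f j) = if i = j then 1 else 0)
    (v : V) : hyperbolicResidue B e f v ∈ B.orthogonal (hyperbolicSpan K e f) := by
  intro w hw
  change B w _ = 0
  induction hw using Submodule.span_induction with
  | mem x hx =>
    obtain ⟨i | i, rfl⟩ := hx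
    · exact bilin_hyperbolicResidue_left hB he hef v i
    · exact bilin_hyperbolicResidue_right hB hf hef v i
  | zero => simp
  | add x y _ _ hx hy => rw [map_add, LinearMap.add_apply, hx, hy, add_zero]
  | smul c x _ hx => rw [map_smul, LinearMap.smul_apply, hx, smul_zero]

theorem exists_hyperbolicCoordinates_even [FiniteDimensional K V]
    (h2 : (2 : K) ≠ 0) (hB : B.IsSymm)
    (hB' : B.Nondegenerate) {L : Submodule K V} (hL : Module.finrank K L = p)
    (hiso : ∀ u ∈ L, ∀ v ∈ L, B u v = 0) (hdim : Module.finrank K V = 2 * p) :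
    ∃ H : HyperbolicCoordinates B p, H.z = 0 := by
  obtain ⟨e, f, he, hf, hef⟩ := exists_hyperbolic_family h2 hB hB' hL hiso
  have hr (v : V) : hyperbolicResidue B e f v = 0 := by
    have h1 := hyperbolicResidue_mem_orthogonal hB he hf hef v
    have h3 : Module.finrank K (B.orthogonal (hyperbolicSpan K e f)) = 0 := by
      rw [LinearMap.BilinForm.finrank_orthogonal hB', finrank_hyperbolicSpan hB he hf hef, hdim,
        Nat.sub_self]
    rwa [Submodule.finrank_eq_zero.1 h3, Submodule.mem_bot] at h1
  exact ⟨{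
    x := fun i => B.flip (f i)
    -- The factor 2 comes from the cross terms `2 B(v, e i) B(v, f i)`.
    y := fun i => (2 : K) • B.flip (e i)
    z := 0
    e := e
    quad := fun v => by
      rw [bilin_self_eq_hyperbolic hB he hf hef v, hr]
      simp
    x_e := fun i j => by simp [hef, eq_comm]
    y_e := fun i j => by simp [he]
    z_e := fun j => rfl
    e_e := he }, rfl⟩

theorem exists_hyperbolicCoordinates_odd [FiniteDimensional K V]
    (h2 : (2 : K) ≠ 0) (hB : B.IsSymm)
    (hB' : B.Nondegenerate) {L : Submodule K V} (hL : Module.finrank K L = p)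
    (hiso : ∀ u ∈ L, ∀ v ∈ L, B u v = 0) (hdim : Module.finrank K V = 2 * p + 1) :
    ∃ c : K, c ≠ 0 ∧ Nonempty (HyperbolicCoordinates (c • B) p) := by
  obtain ⟨e, f, he, hf, hef⟩ := exists_hyperbolic_family h2 hB hB' hL hiso
  have hmem := hyperbolicResidue_mem_orthogonal hB he hf hef
  have h3 : Module.finrank K (B.orthogonal (hyperbolicSpan K e f)) = 1 := by
    rw [LinearMap.BilinForm.finrank_orthogonal hB', finrank_hyperbolicSpan hB he hf hef, hdim,
      Nat.add_sub_cancel_left]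
  obtain ⟨⟨e₀, he₀⟩, hne, hspan⟩ := finrank_eq_one_iff'.1 h3
  have hres (v : V) : ∃ a : K, hyperbolicResidue B e f v = a • e₀ := by
    obtain ⟨a, ha⟩ := hspan ⟨_, hmem v⟩
    exact ⟨a, (congrArg Subtype.val ha).symm⟩
  have hperp (w : V) (hw : w ∈ hyperbolicSpan K e f) : B e₀ w = 0 :=
    (hB.eq _ _).trans (he₀ w hw)
  have hval (v : V) : B e₀ v = B e₀ (hyperbolicResidue B e f v) := by
    have hsum : ∑ i, (B v (f i) • e i + B v (e i) • f i) ∈ hyperbolicSpan K e f :=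
      sum_mem fun i _ => add_mem
        (Submodule.smul_mem _ _ (Submodule.subset_span ⟨Sum.inl i, rfl⟩))
        (Submodule.smul_mem _ _ (Submodule.subset_span ⟨Sum.inr i, rfl⟩))
    rw [hyperbolicResidue, map_sub, hperp _ hsum, sub_zero]
  set d := B e₀ e₀ with hd
  have hd0 : d ≠ 0 := by
    intro h0
    refine hne (Subtype.ext (hB'.1 e₀ fun v => ?_))
    obtain ⟨a, ha⟩ := hres v
    rw [hval, ha, map_smul, ← hd, h0, smul_zero]
  -- The residue is `a • e₀`, contributing `a² d` to `B(v, v)`. Since `d` need not be a square, the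
  -- form is divided by `d`, which leaves `z = a`.
  refine ⟨d⁻¹, inv_ne_zero hd0, ⟨{
    x := fun i => B.flip (f i)
    y := fun i => (d⁻¹ * 2) • B.flip (e i)
    z := d⁻¹ • B e₀
    e := e
    quad := fun v => ?_
    x_e := fun i j => by simp [hef, eq_comm]
    y_e := fun i j => by simp [he]
    z_e := fun j => ?_
    e_e := fun i j => by simp [he] }⟩⟩
  · obtain ⟨a, ha⟩ := hres v
    have hav : B e₀ v = a * d := by rw [hval, ha, map_smul, smul_eq_mul]
    simp only [LinearMap.smul_apply, LinearMap.BilinForm.flip_apply, smul_eq_mul, hav]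
    rw [bilin_self_eq_hyperbolic hB he hf hef v, ha, mul_add, Finset.mul_sum]
    congr 1
    · exact Finset.sum_congr rfl fun i _ => by ring
    · simp only [map_smul, LinearMap.smul_apply, smul_eq_mul, ← hd]
      field_simp
  · rw [LinearMap.smul_apply, hperp (e j) (Submodule.subset_span ⟨Sum.inl j, rfl⟩), smul_zero]

end WittDecomposition

/-! ### Extension of scalars and equations over the base field. -/

section BaseChange

variable {K V : Type*} [Field K] [AddCommGroup V] [Module K V]
  {B : LinearMap.BilinForm K V} {p : ℕ} (F : Type*) [Field F] [Algebra K F]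

/-- A quadratic identity cannot be checked on pure tensors alone, so it is polarized, extended
bilinearly, and restricted to the diagonal. -/
theorem baseChange_quad (h2 : (2 : K) ≠ 0) (hB : B.IsSymm) {x y : Fin p → Module.Dual K V}
    (hq : ∀ v, B v v = ∑ i, x i v * y i v) (w : F ⊗[K] V) :
    B.baseChange F w w = ∑ i, (x i).baseChange F w * (y i).baseChange F w := by
  have hpolar (v v' : V) : 2 * B v v' = ∑ i, (x i v * y i v' + x i v' * y i v) := by
    have h := hq (v + v')
    have hs : B v' v = B v v' := hB.eq _ _
    simp only [map_add, LinearMap.add_apply, hq v, hq v', hs] at h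
    have hsum : ∑ i, (x i v + x i v') * (y i v + y i v') = ∑ i, x i v * y i v +
        ∑ i, x i v' * y i v' + ∑ i, (x i v * y i v' + x i v' * y i v) := by
      simp only [← Finset.sum_add_distrib]
      exact Finset.sum_congr rfl fun i _ => by ring
    linear_combination h + hsum
  have key (w w' : F ⊗[K] V) : 2 * B.baseChange F w w' =
      ∑ i, ((x i).baseChange F w * (y i).baseChange F w' +
        (x i).baseChange F w' * (y i).baseChange F w) := by
    induction w using TensorProduct.induction_on with
    | zero => simp
    | add a b ha hb =>
      simp only [map_add, LinearMap.add_apply, mul_add, ha, hb, add_mul, ← Finset.sum_add_distrib]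
      exact Finset.sum_congr rfl fun i _ => by ring
    | tmul a v =>
      induction w' using TensorProduct.induction_on with
      | zero => simp
      | add b c hb hc =>
        simp only [map_add, mul_add, hb, hc, add_mul, ← Finset.sum_add_distrib]
        exact Finset.sum_congr rfl fun i _ => by ring
      | tmul a' v' =>
        have h := congrArg (algebraMap K F) (hpolar v v')
        simp only [map_mul, map_sum, map_add, map_ofNat] at h
        simp only [LinearMap.BilinForm.baseChange_tmul, Module.Dual.baseChange_apply_tmul,
          Algebra.smul_def]
        rw [← mul_assoc, h, Finset.sum_mul]
        exact Finset.sum_congr rfl fun i _ => by ring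
  have h2F : (2 : F) ≠ 0 := by
    have := (map_ne_zero (algebraMap K F)).2 h2
    rwa [map_ofNat] at this
  refine mul_left_cancel₀ h2F ((key w w).trans ?_)
  rw [Finset.mul_sum]
  exact Finset.sum_congr rfl fun i _ => by ring

/-- Extension of scalars for hyperbolic coordinates of an even-dimensional space. -/
noncomputable def HyperbolicCoordinates.baseChange (H : HyperbolicCoordinates B p)
    (h2 : (2 : K) ≠ 0) (hB : B.IsSymm) (hz : H.z = 0) :
    HyperbolicCoordinates (B.baseChange F) p where
  x i := (H.x i).baseChange F
  y i := (H.y i).baseChange F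
  z := 0
  e i := 1 ⊗ₜ H.e i
  quad w := by
    rw [baseChange_quad F h2 hB (x := H.x) (y := H.y) (fun v => by simp [H.quad v, hz]) w]
    simp
  x_e i j := by
    rw [Module.Dual.baseChange_apply_tmul, H.x_e]
    split_ifs <;> simp
  y_e i j := by simp [H.y_e]
  z_e j := rfl
  e_e i j := by simp [LinearMap.BilinForm.baseChange_tmul, H.e_e]

theorem occupationSign_mem_range (s : Finset (Fin p)) (T : Fin p → Bool) :
    occupationSign F s T ∈ (algebraMap K F).range := by
  refine prod_mem fun j _ => ?_
  split_ifs
  · exact neg_mem (one_mem _)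
  · exact one_mem _

theorem spinMap_tmul_mem_range (x y : Fin p → Module.Dual K V) (v : V) (T S : Fin p → Bool) :
    spinMap (fun i => (x i).baseChange F) (fun i => (y i).baseChange F) 0 (1 ⊗ₜ[K] v) T S ∈
      (algebraMap K F).range := by
  simp only [spinMap, LinearMap.coe_mk, AddHom.coe_mk, Matrix.of_apply, LinearMap.zero_apply,
    zero_mul, ite_self, add_zero]
  refine sum_mem fun i _ => ?_
  split_ifs
  · refine mul_mem ?_ (occupationSign_mem_range F _ _)
    cases T i
    · exact ⟨y i v, by simp [hyperbolicCoord, Algebra.smul_def]⟩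
    · exact ⟨x i v, by simp [hyperbolicCoord, Algebra.smul_def]⟩
  · exact zero_mem _

theorem list_prod_entry_mem {R I : Type*} [CommRing R] [Fintype I] [DecidableEq I]
    (S : Subring R) (l : List (Matrix I I R)) (hl : ∀ M ∈ l, ∀ i j, M i j ∈ S) (i j : I) :
    l.prod i j ∈ S := by
  induction l generalizing i j with
  | nil =>
    rw [List.prod_nil, Matrix.one_apply]
    split_ifs
    · exact one_mem _
    · exact zero_mem _
  | cons M l ih =>
    rw [List.prod_cons, Matrix.mul_apply]
    exact sum_mem fun k _ => mul_mem (hl M (by simp) i k)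
      (ih (fun N hN => hl N (by simp [hN])) k j)

theorem extendScalars_ιMulti {k : ℕ} (v : Fin k → V) :
    extendScalars K F V k (exteriorPower.ιMulti K k v) =
      exteriorPower.ιMulti F k fun i => (1 : F) ⊗ₜ[K] v i := by
  rw [extendScalars, exteriorPower.alternatingMapLinearEquiv_apply_ιMulti]
  rfl

/-- On wedges of an orthogonal `K`-basis the symbol is a product of spin matrices with entries in
`K`; orthogonality of the basis makes the product formula available. -/
theorem HyperbolicCoordinates.symbol_extendScalars_mem_range [FiniteDimensional K V]
    (H : HyperbolicCoordinates B p) (h2 : (2 : K) ≠ 0) (h2F : (2 : F) ≠ 0) (hB : B.IsSymm)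
    (hz : H.z = 0) (ω : ⋀[K]^p V) (T S : Fin p → Bool) :
    (H.baseChange F h2 hB hz).symbol h2F (extendScalars K F V p ω) T S ∈
      (algebraMap K F).range := by
  obtain ⟨u, hu⟩ := HyperbolicCoordinates.exists_orthogonal_basis h2 hB
  have hω : ω ∈ Submodule.span K (Set.range (exteriorPower.ιMulti_family K p u)) := by
    rw [exteriorPower.ιMulti_family_span_of_span K u.span_eq]
    trivial
  induction hω using Submodule.span_induction with
  | mem η hη =>
    obtain ⟨s, rfl⟩ := hη
    rw [exteriorPower.ιMulti_family, extendScalars_ιMulti, symbol, IsCliffordMap.quantize_ιMulti]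
    · refine list_prod_entry_mem _ _ (fun M hM i j => ?_) T S
      obtain ⟨k, rfl⟩ := List.mem_ofFn.1 hM
      exact spinMap_tmul_mem_range F H.x H.y _ i j
    · intro i j hij
      rw [LinearMap.BilinForm.baseChange_tmul]
      simp only [Function.comp_apply]
      rw [hu _ _ fun h => hij.ne ((Set.powersetCard.ofFinEmbEquiv.symm s).injective h), zero_smul]
  | zero =>
    rw [map_zero, map_zero]
    exact zero_mem _
  | add a b _ _ ha hb =>
    rw [map_add, map_add]
    exact add_mem ha hb
  | smul c a _ ha =>
    rw [map_smul, ← algebraMap_smul F c, map_smul, Matrix.smul_apply, smul_eq_mul]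
    exact mul_mem ⟨c, rfl⟩ ha

theorem HyperbolicCoordinates.definedOver_chiralCone [FiniteDimensional K V]
    (H : HyperbolicCoordinates B p) (h2 : (2 : K) ≠ 0) (h2F : (2 : F) ≠ 0) (hB : B.IsSymm)
    (hz : H.z = 0) {ε : F} (hε : ε ∈ (algebraMap K F).range) :
    DefinedByLinearAndQuadricsOver K 4 ((H.baseChange F h2 hB hz).chiralCone h2F ε) := by
  have hmem := H.symbol_extendScalars_mem_range F h2 h2F hB hz
  refine ⟨_, _, ?_, ?_, fun q => quadricRank_le_of_mem_minorQuadrics, rfl⟩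
  · rintro _ ⟨T, S, rfl⟩ ω
    exact mul_mem (sub_mem (occupationSign_mem_range F _ _) hε) (hmem ω T S)
  · rintro _ ⟨i, j, k, l, rfl⟩ ω
    rw [minorQuadric_apply]
    exact sub_mem (mul_mem (hmem ω i j) (hmem ω k l)) (mul_mem (hmem ω i l) (hmem ω k j))

/-- An orthogonal basis over `K` stays orthogonal and anisotropic after base change. -/
theorem nondegenerate_baseChange [FiniteDimensional K V] (h2 : (2 : K) ≠ 0) (hB : B.IsSymm)
    (hB' : B.Nondegenerate) : (B.baseChange F).Nondegenerate := by
  obtain ⟨u, hu⟩ := HyperbolicCoordinates.exists_orthogonal_basis h2 hB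
  have hu0 := LinearMap.BilinForm.iIsOrtho.not_isOrtho_basis_self_of_nondegenerate
    (fun i j hij => hu i j hij) hB'
  refine (LinearMap.BilinForm.iIsOrtho.nondegenerate_iff_not_isOrtho_basis_self
    _ (u.baseChange F) ?_).2 ?_
  · intro i j hij
    change B.baseChange F (u.baseChange F i) (u.baseChange F j) = 0
    rw [Module.Basis.baseChange_apply, Module.Basis.baseChange_apply,
      LinearMap.BilinForm.baseChange_tmul, hu i j hij, zero_smul]
  · intro i
    rw [Module.Basis.baseChange_apply, LinearMap.BilinForm.baseChange_tmul]
    simpa [Algebra.smul_def] using hu0 i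

end BaseChange

/-! ### The main theorem. -/

theorem isoGrassmannCone_smul {K V : Type*} [Field K] [AddCommGroup V] [Module K V]
    (B : LinearMap.BilinForm K V) {c : K} (hc : c ≠ 0) (k : ℕ) :
    isoGrassmannCone (c • B) k = isoGrassmannCone B k := by
  simp [isoGrassmannCone, hc]

/-- `V` is a nondegenerate quadratic space of maximal Witt index `p ≥ 1` over a field `K` of
characteristic not two. If `dim V = 2p + 1`, the maximal isotropic Grassmann cone is
set-theoretically defined by quadrics of rank at most four. If `dim V = 2p`, it has exactly two
irreducible components, each set-theoretically defined by linear equations and quadrics of rank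
at most four: for infinite `K` this holds for the components of the set of `K`-points, and for
every `K` it holds for the components over the algebraic closure, with equations over `K`. -/
theorem mainTheorem3 {K V : Type*} [Field K] (h2 : (2 : K) ≠ 0)
    [AddCommGroup V] [Module K V] [FiniteDimensional K V]
    (B : LinearMap.BilinForm K V) (hsymm : B.IsSymm) (hnondeg : B.Nondegenerate)
    (p : ℕ) (hp : 1 ≤ p)
    (hWitt : ∃ L : Submodule K V, Module.finrank K L = p ∧ ∀ u ∈ L, ∀ v ∈ L, B u v = 0) :
    (Module.finrank K V = 2 * p + 1 → DefinedByQuadrics K 4 (isoGrassmannCone B p)) ∧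
    (Module.finrank K V = 2 * p →
      (Infinite K →
        (zariskiComponents K (isoGrassmannCone B p)).ncard = 2 ∧
        ∀ Z ∈ zariskiComponents K (isoGrassmannCone B p), DefinedByLinearAndQuadrics K 4 Z) ∧
      ((zariskiComponents (AlgebraicClosure K)
          (isoGrassmannCone (B.baseChange (AlgebraicClosure K)) p)).ncard = 2 ∧
        ∀ Z ∈ zariskiComponents (AlgebraicClosure K)
            (isoGrassmannCone (B.baseChange (AlgebraicClosure K)) p),
          DefinedByLinearAndQuadricsOver K 4 Z)) := by
  obtain ⟨L, hL, hiso⟩ := hWitt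
  refine ⟨fun hdim => ?_, fun hdim => ?_⟩
  · obtain ⟨c, hc, ⟨H⟩⟩ := exists_hyperbolicCoordinates_odd h2 hsymm hnondeg hL hiso hdim
    -- Rescaling the form does not change which subspaces are isotropic.
    rw [← isoGrassmannCone_smul B hc]
    have hnd : (c • B).Nondegenerate := by
      refine ⟨fun v hv => hnondeg.1 v fun w => ?_, fun w hw => hnondeg.2 w fun v => ?_⟩
      · simpa [hc] using hv w
      · simpa [hc] using hw v
    exact H.definedByQuadrics h2 (hsymm.smul c) hnd (Or.inr hdim) hp
  · obtain ⟨H, hz⟩ := exists_hyperbolicCoordinates_even h2 hsymm hnondeg hL hiso hdim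
    refine ⟨fun _ => ⟨H.ncard_zariskiComponents_cone h2 hsymm hz hnondeg hdim hp, ?_⟩, ?_⟩
    · rw [H.zariskiComponents_cone h2 hsymm hz hnondeg hdim hp]
      rintro Z (rfl | rfl) <;>
        exact ⟨_, _, fun q => quadricRank_le_of_mem_minorQuadrics, rfl⟩
    · have h2F : (2 : AlgebraicClosure K) ≠ 0 := by
        have := (map_ne_zero (algebraMap K (AlgebraicClosure K))).2 h2
        rwa [map_ofNat] at this
      have hsF := LinearMap.BilinForm.isSymm_iff.2 (LinearMap.BilinForm.IsSymm.baseChange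
        (AlgebraicClosure K) (LinearMap.BilinForm.isSymm_iff.1 hsymm))
      have hnF := nondegenerate_baseChange (AlgebraicClosure K) h2 hsymm hnondeg
      have hdF : Module.finrank (AlgebraicClosure K) (AlgebraicClosure K ⊗[K] V) = 2 * p := by
        rw [Module.finrank_baseChange, hdim]
      have : Infinite (AlgebraicClosure K) := IsAlgClosed.instInfinite
      refine ⟨(H.baseChange (AlgebraicClosure K) h2 hsymm hz).ncard_zariskiComponents_cone h2F hsF
        rfl hnF hdF hp, ?_⟩
      rw [(H.baseChange (AlgebraicClosure K) h2 hsymm hz).zariskiComponents_cone h2F hsF rfl hnF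
        hdF hp]
      rintro Z (rfl | rfl)
      · exact H.definedOver_chiralCone (AlgebraicClosure K) h2 h2F hsymm hz (one_mem _)
      · exact H.definedOver_chiralCone (AlgebraicClosure K) h2 h2F hsymm hz (neg_mem (one_mem _))
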